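/- For $n\ge 1$ let $E_n$ be the edge set of the complete graph on $\{1,\dots,n\}$, and let $\omega=(\omega(e))_{e\in E_n}\in\{0,1\}^{E_n}$ have independent coordinates, each equal to $1$ with probability $1/n$; identify $\omega$ with the graph on $\{1,\dots,n\}$ whose edges are the $e$ with $\omega(e)=1$, which is the Erdős–Rényi graph $\mathrm{ER}(n,1/n)$. Let $|L_n|$ be the number of vertices in its largest connected component. For $\varepsilon\in[0,1]$ let $\omega_\varepsilon$ be obtained from $\omega$ by rerandomizing each bit independently with probability $\varepsilon$, that is, $$\omega_\varepsilon(e)=\omega(e)\mathbf 1_{\{U_e>\varepsilon\}}+\mathbf 1_{\{V_e<1/n\}}\mathbf 1_{\{U_e\le\varepsilon\}},\qquad e\in E_n,$$ where $U_e,V_e$ $(e\in E_n)$ are uniform on $(0,1)$, independent of each other and of $\omega$. Fix $a\in(0,\infty)$ and let $(\varepsilon_n)_{n\ge1}$ be a sequence in $[0,1]$ such that $\lim_{n\to\infty}n^{1/6}\varepsilon_n=\infty$. Then the indicator functions $F_n=\mathbf 1_{\{|L_n|\ge a n^{2/3}\}}$ are quantitatively noise sensitive with scaling $\varepsilon_n$,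 that is, $$\mathbb E[F_n(\omega)F_n(\omega_{\varepsilon_n})]-\mathbb E[F_n(\omega)]^2\to 0\qquad\text{as } n\to\infty.$$ -/

import Mathlib

open Filter Topology MeasureTheory

noncomputable section

namespace NoiseER

/-! Product Bernoulli measures on the discrete cube and rerandomized configurations. -/

section Cube

variable {E : Type} [Fintype E] [DecidableEq E]

/-- The weight `p ^ #{e : ω e = 1} * (1 - p) ^ #{e : ω e = 0}` of a configuration `ω`
(`true` stands for `1` and `false` for `0`). -/
def weight (p : ℝ) (ω : E → Bool) : ℝ :=
  p ^ (Finset.univ.filter fun e => ω e = true).card *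
    (1 - p) ^ (Finset.univ.filter fun e => ω e = false).card

/-- The measure on `{0,1}^E` that gives mass `weight p ω` to each `ω`, for `p ∈ [0,1]`. -/
def bitMeasure (E : Type) [Fintype E] [DecidableEq E] (p : ℝ) : Measure (E → Bool) :=
  ∑ ω : E → Bool, ENNReal.ofReal (weight p ω) • Measure.dirac ω

/-- The law of a family, indexed by `E`, of independent uniform random variables on `(0,1)`. -/
def uniformMeasure (E : Type) [Fintype E] : Measure (E → ℝ) :=
  Measure.pi fun _ => (volume : Measure ℝ).restrict (Set.Ioo 0 1)

/-- The configuration `ω_ε`, as a function of `ω` and of the uniform variables `U` and `V`: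
the bit `e` is kept if `U e > ε`, and is replaced by the indicator of `V e < p` if `U e ≤ ε`. -/
def rerandomize (p ε : ℝ) (ω : E → Bool) (U V : E → ℝ) : E → Bool :=
  fun e => if ε < U e then ω e else decide (V e < p)

/-- `𝔼[f(ω)]`, where `ω` has law `bitMeasure E p`. -/
def expect (p : ℝ) (f : (E → Bool) → ℝ) : ℝ :=
  ∫ ω, f ω ∂(bitMeasure E p)

/-- `𝔼[f(ω) g(ω_ε)]`, where the expectation averages over `ω` and over the independent
families `U` and `V` used to create `ω_ε`. -/
def noisyExpect (p ε : ℝ) (f g : (E → Bool) → ℝ) : ℝ :=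
  ∫ x : (E → Bool) × (E → ℝ) × (E → ℝ), f x.1 * g (rerandomize p ε x.1 x.2.1 x.2.2)
    ∂((bitMeasure E p).prod ((uniformMeasure E).prod (uniformMeasure E)))

end Cube

/-- The sequence `F n : {0,1}^(E n) → ℝ`, where the bits of the `n`-th cube are independent
Bernoulli variables of parameter `p n`, is quantitatively noise sensitive with scaling `ε n`. -/
def QuantNoiseSensitive (E : ℕ → Type) [∀ n, Fintype (E n)] [∀ n, DecidableEq (E n)]
    (p : ℕ → ℝ) (F : ∀ n, (E n → Bool) → ℝ) (ε : ℕ → ℝ) : Prop :=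
  Tendsto (fun n => noisyExpect (p n) (ε n) (F n) (F n) - expect (p n) (F n) ^ 2) atTop (𝓝 0)

/-! Component sizes in the Erdős–Rényi graph. -/

/-- The edge set of the complete graph on `n` vertices. -/
abbrev KEdge (n : ℕ) : Type := (⊤ : SimpleGraph (Fin n)).edgeSet

/-- The graph on `n` vertices whose edges are the pairs `e` with `ω e = 1`. -/
def graphOf {n : ℕ} (ω : KEdge n → Bool) : SimpleGraph (Fin n) :=
  SimpleGraph.fromEdgeSet {e | ∃ h : e ∈ (⊤ : SimpleGraph (Fin n)).edgeSet, ω ⟨e, h⟩ = true}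

/-- The number of vertices of a largest connected component of a graph on `n` vertices. -/
def largestComponentSize {n : ℕ} (G : SimpleGraph (Fin n)) : ℕ :=
  ⨆ c : G.ConnectedComponent, c.supp.ncard

open Classical in
/-- The indicator of the event that the largest component has at least `a n ^ (2/3)` vertices. -/
def largeComponentIndicator (a : ℝ) (n : ℕ) (ω : KEdge n → Bool) : ℝ :=
  if a * (n : ℝ) ^ (2 / 3 : ℝ) ≤ (largestComponentSize (graphOf ω) : ℝ) then 1 else 0

end NoiseER

end

/-! Let M = ⌈a n^(2/3)⌉, so that F is the indicator that some component has at least M vertices.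
Choose every vertex as a seed independently with probability q = K/n^(2/3), and let g(ω) be the
probability, over the seeds only, that some seed lies in such a component. A component with M
vertices is missed with probability at most (1-q)^M ≤ exp(-aK), hence F and g are uniformly close
(`abs_indicator_sub_ex_seedInd_le`).

For fixed seeds, the event is decided by exploring from each seed and stopping before M vertices are
reached. The Schramm–Steif inequality, averaged over the seeds (`fourier_weight_le`), bounds the
Fourier weight of g on level k by kδ, where δ bounds the probability that a given edge is revealed.
Noise multiplies level k by (1-ε)^k, and ∑ k (1-ε)^k ≤ 1/ε², so the noise covariance of F is at most
2δ/ε² + 2 exp(-aK)² (`noisyExpect_sub_sq_le`).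

It remains to bound δ. By exchangeability of the vertices, the expected number of r whose
exploration reaches a given vertex is the mean size of one exploration, which is at most E
min(|C(v)|, M). At p = 1/n this is at most 4√M (`ex_min_cluster_le`): if θ is the largest
probability that a component meets an independent ghost set of density γ, then 1-θ ≥ exp(-θ)-γ,
which forces θ ≤ 2√γ, and γ = 1/M gives the claim. Thus δ = 8q√M, and δ/ε² is of order K/(n^(1/6)
ε)². Letting n → ∞ and then K → ∞ finishes the proof. -/

noncomputable section

namespace NoiseER

/-! ### Expectations and Fourier–Walsh analysis on the biased cube -/

section Fourier

variable {E : Type} [Fintype E] [DecidableEq E]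

/-- The mass of a single bit under the Bernoulli law of parameter `p`. -/
def bitMass (p : ℝ) (b : Bool) : ℝ := if b then p else 1 - p

theorem weight_eq_prod (p : ℝ) (ω : E → Bool) : weight p ω = ∏ e, bitMass p (ω e) := by
  unfold weight bitMass
  rw [Finset.prod_ite, Finset.prod_const, Finset.prod_const]
  simp

theorem bitMass_nonneg {p : ℝ} (h0 : 0 ≤ p) (h1 : p ≤ 1) (b : Bool) : 0 ≤ bitMass p b := by
  unfold bitMass; split_ifs <;> linarith

theorem weight_nonneg {p : ℝ} (h0 : 0 ≤ p) (h1 : p ≤ 1) (ω : E → Bool) : 0 ≤ weight p ω := by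
  rw [weight_eq_prod]; exact Finset.prod_nonneg fun e _ => bitMass_nonneg h0 h1 _

/-- The finite sum that computes expectations on the Bernoulli cube. -/
def ex (p : ℝ) (f : (E → Bool) → ℝ) : ℝ := ∑ ω, weight p ω * f ω

theorem sum_prod_bool (g : E → Bool → ℝ) :
    ∑ ω : E → Bool, ∏ e, g e (ω e) = ∏ e, (g e true + g e false) := by
  have := Finset.prod_univ_sum (fun _ : E => (Finset.univ : Finset Bool)) g
  simp only [Fintype.piFinset_univ, Fintype.sum_bool] at this
  exact this.symm

theorem ex_const (p c : ℝ) : ex p (fun _ : E → Bool => c) = c := by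
  unfold ex
  rw [← Finset.sum_mul]
  simp_rw [weight_eq_prod]
  rw [sum_prod_bool (fun _ b => bitMass p b)]
  simp [bitMass]

theorem ex_add (p : ℝ) (f g : (E → Bool) → ℝ) :
    ex p (fun ω => f ω + g ω) = ex p f + ex p g := by
  simp [ex, mul_add, Finset.sum_add_distrib]

theorem ex_sub (p : ℝ) (f g : (E → Bool) → ℝ) :
    ex p (fun ω => f ω - g ω) = ex p f - ex p g := by
  simp [ex, mul_sub, Finset.sum_sub_distrib]

theorem ex_const_mul (p c : ℝ) (f : (E → Bool) → ℝ) :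
    ex p (fun ω => c * f ω) = c * ex p f := by
  simp only [ex, Finset.mul_sum]
  exact Finset.sum_congr rfl fun _ _ => by ring

theorem ex_sum {ι : Type*} (p : ℝ) (s : Finset ι) (f : ι → (E → Bool) → ℝ) :
    ex p (fun ω => ∑ i ∈ s, f i ω) = ∑ i ∈ s, ex p (f i) := by
  simp only [ex, Finset.mul_sum]
  exact Finset.sum_comm

theorem ex_mono {p : ℝ} (h0 : 0 ≤ p) (h1 : p ≤ 1) {f g : (E → Bool) → ℝ}
    (h : ∀ ω, f ω ≤ g ω) : ex p f ≤ ex p g :=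
  Finset.sum_le_sum fun ω _ => mul_le_mul_of_nonneg_left (h ω) (weight_nonneg h0 h1 ω)

theorem ex_nonneg {p : ℝ} (h0 : 0 ≤ p) (h1 : p ≤ 1) {f : (E → Bool) → ℝ}
    (h : ∀ ω, 0 ≤ f ω) : 0 ≤ ex p f :=
  Finset.sum_nonneg fun ω _ => mul_nonneg (weight_nonneg h0 h1 ω) (h ω)

theorem ex_comm {E' : Type} [Fintype E'] [DecidableEq E'] (p q : ℝ)
    (f : (E → Bool) → (E' → Bool) → ℝ) :
    ex p (fun ω => ex q (f ω)) = ex q (fun η => ex p fun ω => f ω η) := by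
  simp only [ex, Finset.mul_sum]
  rw [Finset.sum_comm]
  exact Finset.sum_congr rfl fun _ _ => Finset.sum_congr rfl fun _ _ => by ring

/-- Flipping one bit. -/
def flipBit (e : E) : (E → Bool) ≃ (E → Bool) :=
  Function.Involutive.toPerm (fun ω => Function.update ω e (!ω e)) fun ω => by
    simp

/-- Pair each configuration with its flip at `e`. The sum is unweighted, so that the mass of the bit
can be absorbed into `t`. -/
theorem sum_coord_mul (e : E) (t : Bool → ℝ) (k : (E → Bool) → ℝ)
    (hk : ∀ ω b, k (Function.update ω e b) = k ω) :
    ∑ ω, t (ω e) * k ω = (t true + t false) / 2 * ∑ ω, k ω := by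
  have h := Equiv.sum_comp (flipBit e) fun ω => t (ω e) * k ω
  have h2 : ∀ ω, t (flipBit e ω e) * k (flipBit e ω) = t (!ω e) * k ω := by
    intro ω
    simp [flipBit, Function.Involutive.toPerm, hk]
  simp_rw [h2] at h
  have h3 : ∑ ω, t (ω e) * k ω + ∑ ω, t (!ω e) * k ω = (t true + t false) * ∑ ω, k ω := by
    rw [← Finset.sum_add_distrib, Finset.mul_sum]
    refine Finset.sum_congr rfl fun ω _ => ?_
    cases ω e <;> simp <;> ring
  linarith

/-- A factor that depends only on the bit `e` can be averaged separately from a function that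
does not depend on this bit. -/
theorem ex_coord_mul (p : ℝ) (e : E) (t : Bool → ℝ) (k : (E → Bool) → ℝ)
    (hk : ∀ ω b, k (Function.update ω e b) = k ω) :
    ex p (fun ω => t (ω e) * k ω) = (p * t true + (1 - p) * t false) * ex p k := by
  set k' : (E → Bool) → ℝ := fun ω => (∏ x ∈ Finset.univ.erase e, bitMass p (ω x)) * k ω
  have hk' : ∀ ω b, k' (Function.update ω e b) = k' ω := by
    intro ω b
    simp only [k', hk]
    congr 1
    refine Finset.prod_congr rfl fun x hx => ?_
    rw [Function.update_of_ne (Finset.ne_of_mem_erase hx)]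
  have hw : ∀ ω : E → Bool, weight p ω =
      bitMass p (ω e) * ∏ x ∈ Finset.univ.erase e, bitMass p (ω x) := fun ω => by
    rw [weight_eq_prod, Finset.mul_prod_erase _ (fun x => bitMass p (ω x)) (Finset.mem_univ e)]
  have h1 := sum_coord_mul e (fun b => bitMass p b * t b) k' hk'
  have h2 := sum_coord_mul e (bitMass p) k' hk'
  have e1 : ex p (fun ω => t (ω e) * k ω) = ∑ ω, bitMass p (ω e) * t (ω e) * k' ω :=
    Finset.sum_congr rfl fun ω _ => by rw [hw]; simp only [k']; ring
  have e2 : ex p k = ∑ ω, bitMass p (ω e) * k' ω :=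
    Finset.sum_congr rfl fun ω _ => by rw [hw]; simp only [k']; ring
  rw [e1, e2, h1, h2]
  simp [bitMass]
  ring

theorem ex_coord (p : ℝ) (e : E) :
    ex p (fun ω : E → Bool => if ω e = true then (1 : ℝ) else 0) = p := by
  have := ex_coord_mul p e (fun b => if b = true then (1 : ℝ) else 0) (fun _ => 1) (fun _ _ => rfl)
  rw [ex_const] at this
  simpa using this

theorem ex_prod_mul (p : ℝ) (A : Finset E) (t : E → Bool → ℝ) (k : (E → Bool) → ℝ)
    (hk : ∀ e ∈ A, ∀ ω b, k (Function.update ω e b) = k ω) :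
    ex p (fun ω => (∏ e ∈ A, t e (ω e)) * k ω) =
      (∏ e ∈ A, (p * t e true + (1 - p) * t e false)) * ex p k := by
  induction A using Finset.induction_on with
  | empty => simp
  | insert a A ha ih =>
    have := ex_coord_mul p a (t a) (fun ω => (∏ e ∈ A, t e (ω e)) * k ω) (by
      intro ω b
      simp only [hk a (Finset.mem_insert_self a A)]
      congr 1
      refine Finset.prod_congr rfl fun x hx => ?_
      rw [Function.update_of_ne (by rintro rfl; exact ha hx)])
    rw [ih fun e he => hk e (Finset.mem_insert_of_mem he)] at this
    rw [Finset.prod_insert ha, mul_assoc, ← this]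
    simp_rw [Finset.prod_insert ha, mul_assoc]

theorem ex_prod_const_mul (p : ℝ) (A : Finset E) (t : Bool → ℝ) (k : (E → Bool) → ℝ)
    (hk : ∀ e ∈ A, ∀ ω b, k (Function.update ω e b) = k ω) :
    ex p (fun ω => (∏ e ∈ A, t (ω e)) * k ω) =
      (p * t true + (1 - p) * t false) ^ A.card * ex p k := by
  rw [ex_prod_mul p A (fun _ => t) k hk, Finset.prod_const]

/-- The standardized bit. -/
def stdBit (p : ℝ) (b : Bool) : ℝ := ((if b then 1 else 0) - p) / √(p * (1 - p))

/-- The `p`-biased Walsh character. -/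
def chi (p : ℝ) (S : Finset E) (ω : E → Bool) : ℝ := ∏ e ∈ S, stdBit p (ω e)

/-- The `p`-biased Fourier–Walsh coefficient. -/
def fhat (p : ℝ) (f : (E → Bool) → ℝ) (S : Finset E) : ℝ := ex p fun ω => f ω * chi p S ω

theorem stdBit_mean (p : ℝ) : p * stdBit p true + (1 - p) * stdBit p false = 0 := by
  simp [stdBit]; ring

theorem stdBit_mul {p : ℝ} (h0 : 0 < p) (h1 : p < 1) (b b' : Bool) :
    stdBit p b * stdBit p b' =
      ((if b then 1 else 0) - p) * ((if b' then 1 else 0) - p) / (p * (1 - p)) := by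
  unfold stdBit
  rw [div_mul_div_comm, Real.mul_self_sqrt (by nlinarith)]

theorem stdBit_var {p : ℝ} (h0 : 0 < p) (h1 : p < 1) :
    p * (stdBit p true * stdBit p true) + (1 - p) * (stdBit p false * stdBit p false) = 1 := by
  have : 1 - p ≠ 0 := by linarith
  rw [stdBit_mul h0 h1, stdBit_mul h0 h1]
  simp
  field_simp
  ring

/-- The right side is the transition probability of one rerandomized bit; the left side diagonalizes
it in the basis 1, `stdBit`, with eigenvalues 1 and 1 - ε. -/
theorem bitMass_mul_kernel {p : ℝ} (h0 : 0 < p) (h1 : p < 1) (ε : ℝ) (b b' : Bool) :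
    bitMass p b' * (1 + (1 - ε) * (stdBit p b * stdBit p b')) =
      (1 - ε) * (if b = b' then 1 else 0) + ε * bitMass p b' := by
  have : 1 - p ≠ 0 := by linarith
  rw [stdBit_mul h0 h1]
  cases b <;> cases b' <;> simp [bitMass] <;> field_simp <;> ring

theorem sum_pow_card_mul_fhat (p ρ : ℝ) (f g : (E → Bool) → ℝ) :
    ∑ S : Finset E, ρ ^ S.card * (fhat p f S * fhat p g S) =
      ∑ ω, ∑ η, weight p ω * weight p η * (f ω * g η) *
        ∏ e, (1 + ρ * (stdBit p (ω e) * stdBit p (η e))) := by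
  have h : ∀ ω η : E → Bool, ∏ e, (1 + ρ * (stdBit p (ω e) * stdBit p (η e))) =
      ∑ S : Finset E, ρ ^ S.card * (chi p S ω * chi p S η) := by
    intro ω η
    rw [Finset.prod_one_add, Finset.powerset_univ]
    refine Finset.sum_congr rfl fun S _ => ?_
    rw [Finset.prod_mul_distrib, Finset.prod_mul_distrib, Finset.prod_const]
    rfl
  simp_rw [h, Finset.mul_sum]
  simp_rw [Finset.sum_comm (t := (Finset.univ : Finset (Finset E)))]
  refine Finset.sum_congr rfl fun S _ => ?_
  unfold fhat ex
  rw [Finset.sum_mul_sum, Finset.mul_sum]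
  refine Finset.sum_congr rfl fun ω _ => ?_
  rw [Finset.mul_sum]
  exact Finset.sum_congr rfl fun η _ => by ring

theorem sum_pow_card_mul_fhat_kernel {p : ℝ} (h0 : 0 < p) (h1 : p < 1) (ε : ℝ)
    (f g : (E → Bool) → ℝ) :
    ∑ S : Finset E, (1 - ε) ^ S.card * (fhat p f S * fhat p g S) =
      ∑ ω, weight p ω * (f ω * ∑ η, g η *
        ∏ e, ((1 - ε) * (if ω e = η e then 1 else 0) + ε * bitMass p (η e))) := by
  rw [sum_pow_card_mul_fhat]
  refine Finset.sum_congr rfl fun ω _ => ?_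
  simp_rw [Finset.mul_sum]
  refine Finset.sum_congr rfl fun η _ => ?_
  simp_rw [← bitMass_mul_kernel h0 h1, Finset.prod_mul_distrib, ← weight_eq_prod]
  ring

/-- At ε = 0 the noise kernel is the identity, so no separate completeness argument for the
characters is needed. -/
theorem parseval {p : ℝ} (h0 : 0 < p) (h1 : p < 1) (f : (E → Bool) → ℝ) :
    ∑ S : Finset E, fhat p f S ^ 2 = ex p fun ω => f ω ^ 2 := by
  have h := sum_pow_card_mul_fhat_kernel h0 h1 0 f f
  simp only [sub_zero, one_pow, one_mul, zero_mul, add_zero] at h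
  simp_rw [pow_two]
  rw [h]
  refine Finset.sum_congr rfl fun ω _ => ?_
  congr 2
  rw [Finset.sum_eq_single ω]
  · simp
  · intro η _ hη
    obtain ⟨e, he⟩ := Function.ne_iff.mp hη
    rw [Finset.prod_eq_zero (Finset.mem_univ e) (by simp [he.symm]), mul_zero]
  · simp

theorem fhat_empty (p : ℝ) (f : (E → Bool) → ℝ) : fhat p f ∅ = ex p f := by
  simp [fhat, chi]

theorem fhat_sub (p : ℝ) (f g : (E → Bool) → ℝ) (S : Finset E) :
    fhat p (fun ω => f ω - g ω) S = fhat p f S - fhat p g S := by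
  unfold fhat
  rw [← ex_sub]
  simp only [sub_mul]

theorem ex_chi_mul_eq_zero (p : ℝ) {T : Finset E} {e : E} (he : e ∈ T) (k : (E → Bool) → ℝ)
    (hk : ∀ ω b, k (Function.update ω e b) = k ω) :
    ex p (fun ω => chi p T ω * k ω) = 0 := by
  have := ex_coord_mul p e (stdBit p) (fun ω => chi p (T.erase e) ω * k ω) (by
    intro ω b
    simp only [hk, chi]
    congr 1
    refine Finset.prod_congr rfl fun x hx => ?_
    rw [Function.update_of_ne (Finset.ne_of_mem_erase hx)])
  rw [stdBit_mean, zero_mul] at this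
  rw [← this]
  congr 1; funext ω
  rw [← mul_assoc, chi, chi, Finset.mul_prod_erase _ (fun x => stdBit p (ω x)) he]

/-- Distinct sets of equal size leave an element of T outside S, whose centred bit averages to zero.
This is why `k` need only ignore the bits of T, not those of S. -/
theorem ex_chi_mul_chi {p : ℝ} (h0 : 0 < p) (h1 : p < 1) {S T : Finset E}
    (hST : S.card = T.card) (k : (E → Bool) → ℝ)
    (hk : ∀ e ∈ T, ∀ ω b, k (Function.update ω e b) = k ω) :
    ex p (fun ω => chi p S ω * chi p T ω * k ω) = if S = T then ex p k else 0 := by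
  split_ifs with h
  · subst h
    have := ex_prod_const_mul p S (fun b => stdBit p b * stdBit p b) k hk
    rw [stdBit_var h0 h1, one_pow, one_mul] at this
    rw [← this]
    simp only [chi, Finset.prod_mul_distrib]
  · obtain ⟨e, heT, heS⟩ : ∃ e ∈ T, e ∉ S := by
      by_contra! hc
      exact h (Finset.eq_of_subset_of_card_le hc hST.le).symm
    rw [← ex_chi_mul_eq_zero p heT (fun ω => chi p S ω * k ω)]
    · congr 1; funext ω; ring
    · intro ω b
      simp only [hk e heT, chi]
      congr 1
      refine Finset.prod_congr rfl fun x hx => ?_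
      rw [Function.update_of_ne (by rintro rfl; exact heS hx)]

/-! ### Stopping sets and the Schramm–Steif inequality -/

/-- `J` is a stopping set: it is determined by the bits that it reveals. -/
def IsStoppingSet (J : (E → Bool) → Finset E) : Prop :=
  ∀ ω η, (∀ e ∈ J ω, ω e = η e) → J η = J ω

/-- The function `h` is determined by the bits that `J` reveals. -/
def DeterminedBy (h : (E → Bool) → ℝ) (J : (E → Bool) → Finset E) : Prop :=
  ∀ ω η, (∀ e ∈ J ω, ω e = η e) → h η = h ω

open Classical in
/-- The indicator that no bit of `T` is revealed. -/
def missInd (J : (E → Bool) → Finset E) (T : Finset E) (ω : E → Bool) : ℝ :=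
  if Disjoint T (J ω) then 1 else 0

theorem IsStoppingSet.eq_update {J : (E → Bool) → Finset E} (hJ : IsStoppingSet J) {T : Finset E}
    {e : E} (he : e ∈ T) {ω : E → Bool} (b : Bool) (hd : Disjoint T (J ω)) :
    J (Function.update ω e b) = J ω := by
  refine hJ _ _ fun x hx => ?_
  rw [Function.update_of_ne]
  rintro rfl
  exact Finset.disjoint_left.mp hd he hx

theorem IsStoppingSet.disjoint_update {J : (E → Bool) → Finset E} (hJ : IsStoppingSet J)
    {T : Finset E} {e : E} (he : e ∈ T) (ω : E → Bool) (b : Bool) :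
    Disjoint T (J (Function.update ω e b)) ↔ Disjoint T (J ω) := by
  constructor
  · intro hd
    have := hJ.eq_update he (ω e) hd
    rw [Function.update_idem, Function.update_eq_self] at this
    rwa [this]
  · intro hd
    rwa [hJ.eq_update he b hd]

theorem IsStoppingSet.missInd_update {J : (E → Bool) → Finset E} (hJ : IsStoppingSet J)
    {T : Finset E} {e : E} (he : e ∈ T) (ω : E → Bool) (b : Bool) :
    missInd J T (Function.update ω e b) = missInd J T ω := by
  simp only [missInd, hJ.disjoint_update he]

theorem IsStoppingSet.missInd_mul_update {J : (E → Bool) → Finset E} (hJ : IsStoppingSet J)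
    {h : (E → Bool) → ℝ} (hh : DeterminedBy h J)
    {T : Finset E} {e : E} (he : e ∈ T) (ω : E → Bool) (b : Bool) :
    missInd J T (Function.update ω e b) * h (Function.update ω e b) = missInd J T ω * h ω := by
  rw [hJ.missInd_update he]
  unfold missInd
  split_ifs with hd
  · rw [hh ω (Function.update ω e b)]
    intro x hx
    rw [Function.update_of_ne]
    rintro rfl
    exact Finset.disjoint_left.mp hd he hx
  · simp

theorem missInd_union (J : (E → Bool) → Finset E) (S T : Finset E) (ω : E → Bool) :
    missInd J (S ∪ T) ω = missInd J S ω * missInd J T ω := by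
  simp only [missInd, Finset.disjoint_union_left]
  by_cases h1 : Disjoint S (J ω) <;> by_cases h2 : Disjoint T (J ω) <;> simp [h1, h2]

/-- Characters of one level stay orthogonal after restriction to the event that their set is hit.
Expanding the two factors `1 - missInd` gives four terms, and in each the remaining factor ignores
the bits of S or of T, so `ex_chi_mul_chi` applies. -/
theorem ex_sq_revealed {p : ℝ} (h0 : 0 < p) (h1 : p < 1) {J : (E → Bool) → Finset E}
    (hJ : IsStoppingSet J) (k : ℕ) (c : Finset E → ℝ) :
    ex p (fun ω => (∑ T ∈ Finset.powersetCard k Finset.univ,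
        c T * (chi p T ω * (1 - missInd J T ω))) ^ 2) =
      ∑ T ∈ Finset.powersetCard k Finset.univ, c T ^ 2 * (1 - ex p (missInd J T)) := by
  have key : ∀ S ∈ Finset.powersetCard k (Finset.univ : Finset E),
      ∀ T ∈ Finset.powersetCard k (Finset.univ : Finset E),
      ex p (fun ω => c S * (chi p S ω * (1 - missInd J S ω)) *
        (c T * (chi p T ω * (1 - missInd J T ω)))) =
      if S = T then c T ^ 2 * (1 - ex p (missInd J T)) else 0 := by
    intro S hS T hT
    have hST : S.card = T.card := by
      rw [(Finset.mem_powersetCard.mp hS).2, (Finset.mem_powersetCard.mp hT).2]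
    have a1 := ex_chi_mul_chi h0 h1 hST (fun _ => (1 : ℝ)) (fun _ _ _ _ => rfl)
    have a2 := ex_chi_mul_chi h0 h1 hST (missInd J T) (fun e he => hJ.missInd_update he)
    have a3 := ex_chi_mul_chi h0 h1 hST.symm (missInd J S) (fun e he => hJ.missInd_update he)
    have a4 := ex_chi_mul_chi h0 h1 hST (missInd J (S ∪ T))
      (fun e he => hJ.missInd_update (Finset.mem_union_right S he))
    have hsum : ex p (fun ω => c S * (chi p S ω * (1 - missInd J S ω)) *
        (c T * (chi p T ω * (1 - missInd J T ω)))) =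
        c S * c T * (ex p (fun ω => chi p S ω * chi p T ω * 1)
          - ex p (fun ω => chi p S ω * chi p T ω * missInd J T ω)
          - ex p (fun ω => chi p T ω * chi p S ω * missInd J S ω)
          + ex p (fun ω => chi p S ω * chi p T ω * missInd J (S ∪ T) ω)) := by
      rw [← ex_sub, ← ex_sub, ← ex_add, ← ex_const_mul]
      congr 1; funext ω
      rw [missInd_union]; ring
    rw [hsum, a1, a2, a3, a4]
    by_cases h : S = T
    · subst h
      simp only [if_true, Finset.union_self, ex_const]
      ring
    · simp [h, Ne.symm h]
  simp_rw [pow_two, Finset.sum_mul_sum]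
  rw [ex_sum]
  simp_rw [ex_sum]
  rw [Finset.sum_congr rfl fun S hS => Finset.sum_congr rfl fun T hT => key S hS T hT]
  refine Finset.sum_congr rfl fun S hS => ?_
  rw [Finset.sum_ite_eq]
  simp only [hS, if_true, pow_two]

open Classical in
theorem one_sub_ex_missInd_le {p : ℝ} (h0 : 0 ≤ p) (h1 : p ≤ 1) (J : (E → Bool) → Finset E)
    (T : Finset E) :
    1 - ex p (missInd J T) ≤ ∑ e ∈ T, ex p fun ω => if e ∈ J ω then (1 : ℝ) else 0 := by
  have h : 1 - ex p (missInd J T) = ex p fun ω => 1 - missInd J T ω := by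
    rw [ex_sub, ex_const]
  rw [h, ← ex_sum]
  refine ex_mono h0 h1 fun ω => ?_
  have hn : ∀ e ∈ T, (0 : ℝ) ≤ if e ∈ J ω then 1 else 0 := fun e _ => by split_ifs <;> norm_num
  unfold missInd
  split_ifs with hd
  · simp
  · obtain ⟨e, he, heJ⟩ := Finset.not_disjoint_iff.mp hd
    refine le_trans ?_ (Finset.single_le_sum hn he)
    simp [heJ]

open Classical in
/-- The Schramm–Steif bound: an average of functions, each of which is determined by a stopping
set, has small Fourier weight on low levels if every bit is unlikely to be revealed. -/
theorem fourier_weight_le {p : ℝ} (h0 : 0 < p) (h1 : p < 1) {V : Type} [Fintype V] [DecidableEq V]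
    {q : ℝ} (hq0 : 0 ≤ q) (hq1 : q ≤ 1) (J : (V → Bool) → (E → Bool) → Finset E)
    (h : (V → Bool) → (E → Bool) → ℝ) (hJ : ∀ R, IsStoppingSet (J R))
    (hh : ∀ R, DeterminedBy (h R) (J R)) (hb : ∀ R ω, h R ω ^ 2 ≤ 1) {δ : ℝ} (hδ : 0 < δ)
    (hrev : ∀ e, ex q (fun R => ex p fun ω => if e ∈ J R ω then (1 : ℝ) else 0) ≤ δ)
    {k : ℕ} (hk : 1 ≤ k) :
    ∑ S ∈ Finset.powersetCard k Finset.univ, fhat p (fun ω => ex q fun R => h R ω) S ^ 2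
      ≤ k * δ := by
  set c : Finset E → ℝ := fhat p fun ω => ex q fun R => h R ω with hc
  set W : ℝ := ∑ S ∈ Finset.powersetCard k Finset.univ, c S ^ 2 with hW
  -- The level-k part of the averaged function, keeping only the characters whose set meets the
  -- revealed bits; the discarded ones are orthogonal to `h R`.
  let x : (V → Bool) → (E → Bool) → ℝ := fun R ω =>
    ∑ T ∈ Finset.powersetCard k Finset.univ, c T * (chi p T ω * (1 - missInd (J R) T ω))
  have hkδ : 0 < (k : ℝ) * δ := by positivity
  have e1 : W = ex q fun R => ex p fun ω => x R ω * h R ω := by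
    have : ∀ R, ex p (fun ω => x R ω * h R ω) =
        ∑ T ∈ Finset.powersetCard k Finset.univ, c T * ex p fun ω => h R ω * chi p T ω := by
      intro R
      simp only [x, Finset.sum_mul]
      rw [ex_sum]
      refine Finset.sum_congr rfl fun T hT => ?_
      obtain ⟨e, he⟩ : T.Nonempty := by
        rw [← Finset.card_pos, (Finset.mem_powersetCard.mp hT).2]; omega
      -- When no bit of T is revealed, changing a bit of T alters neither that event nor the value
      -- of `h R`.
      have hz := ex_chi_mul_eq_zero p he (fun ω => missInd (J R) T ω * h R ω)
        (fun ω b => (hJ R).missInd_mul_update (hh R) he ω b)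
      rw [← sub_zero (ex p fun ω => h R ω * chi p T ω), ← hz, ← ex_sub, ← ex_const_mul]
      congr 1; funext ω; ring
    simp_rw [this]
    rw [ex_sum]
    refine Finset.sum_congr rfl fun T _ => ?_
    rw [ex_const_mul, pow_two]
    congr 1
    rw [hc, fhat, ex_comm]
    congr 1; funext ω
    rw [mul_comm, ← ex_const_mul]
    congr 1; funext R; ring
  have e2 : ex q (fun R => ex p fun ω => x R ω ^ 2) ≤ k * δ * W := by
    have : ∀ R, ex p (fun ω => x R ω ^ 2) ≤ ∑ T ∈ Finset.powersetCard k Finset.univ,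
        c T ^ 2 * ∑ e ∈ T, ex p fun ω => if e ∈ J R ω then (1 : ℝ) else 0 := by
      intro R
      rw [ex_sq_revealed h0 h1 (hJ R)]
      exact Finset.sum_le_sum fun T _ => mul_le_mul_of_nonneg_left
        (one_sub_ex_missInd_le h0.le h1.le _ _) (sq_nonneg _)
    refine (ex_mono hq0 hq1 this).trans ?_
    rw [ex_sum, hW, Finset.mul_sum]
    refine Finset.sum_le_sum fun T hT => ?_
    rw [ex_const_mul, ex_sum, mul_comm (_ * δ)]
    refine mul_le_mul_of_nonneg_left ?_ (sq_nonneg _)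
    refine (Finset.sum_le_sum fun e _ => hrev e).trans ?_
    rw [Finset.sum_const, (Finset.mem_powersetCard.mp hT).2, nsmul_eq_mul]
  -- The weighted inequality 2xh ≤ x²/(kδ) + kδ h² replaces Cauchy–Schwarz; with `e2` it becomes W ≤
  -- W/2 + kδ/2.
  have e3 : W ≤ ex q fun R => ex p fun ω => (x R ω ^ 2 / (k * δ) + k * δ) / 2 := by
    rw [e1]
    refine ex_mono hq0 hq1 fun R => ex_mono h0.le h1.le fun ω => ?_
    have hs := sq_nonneg (x R ω - k * δ * h R ω)
    have hb' := mul_le_mul_of_nonneg_left (hb R ω) (sq_nonneg (k * δ))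
    rw [le_div_iff₀ two_pos, ← sub_le_iff_le_add, le_div_iff₀ hkδ]
    nlinarith
  have e4 : ex q (fun R => ex p fun ω => (x R ω ^ 2 / (k * δ) + k * δ) / 2) =
      (1 / (2 * (k * δ))) * ex q (fun R => ex p fun ω => x R ω ^ 2) + k * δ / 2 := by
    rw [← ex_const_mul, ← ex_const (E := V) q (k * δ / 2), ← ex_add]
    congr 1; funext R
    rw [← ex_const_mul, ← ex_const (E := E) p (k * δ / 2), ← ex_add]
    congr 1; funext ω
    field_simp
  rw [e4] at e3
  have e5 : 1 / (2 * (k * δ)) * ex q (fun R => ex p fun ω => x R ω ^ 2) ≤ W / 2 := by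
    refine (mul_le_mul_of_nonneg_left e2 (by positivity)).trans (le_of_eq ?_)
    field_simp
  linarith

end Fourier

/-! ### The noise operator and the noise covariance -/

section Noise

variable {E : Type} [Fintype E] [DecidableEq E]

theorem integral_bitMeasure {p : ℝ} (h0 : 0 ≤ p) (h1 : p ≤ 1) (f : (E → Bool) → ℝ) :
    ∫ ω, f ω ∂(bitMeasure E p) = ex p f := by
  unfold bitMeasure ex
  rw [integral_finsetSum_measure fun ω _ =>
    ((integrable_dirac (by simp)).smul_measure ENNReal.ofReal_ne_top)]
  refine Finset.sum_congr rfl fun ω _ => ?_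
  rw [integral_smul_measure, integral_dirac, ENNReal.toReal_ofReal (weight_nonneg h0 h1 ω)]
  rfl

instance isFiniteMeasure_bitMeasure (p : ℝ) : IsFiniteMeasure (bitMeasure E p) := by
  unfold bitMeasure
  refine ⟨?_⟩
  simp only [Measure.coe_finsetSum, Finset.sum_apply, Measure.smul_apply, measure_univ,
    smul_eq_mul, mul_one]
  exact ENNReal.sum_lt_top.mpr fun _ _ => ENNReal.ofReal_lt_top

instance isProbabilityMeasure_Ioo :
    IsProbabilityMeasure ((volume : Measure ℝ).restrict (Set.Ioo 0 1)) :=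
  ⟨by simp⟩

instance isProbabilityMeasure_uniformMeasure : IsProbabilityMeasure (uniformMeasure E) := by
  unfold uniformMeasure; infer_instance

theorem integral_Ioo_ite {c : ℝ} (h0 : 0 ≤ c) (h1 : c ≤ 1) (A B : ℝ) :
    ∫ v in Set.Ioo (0 : ℝ) 1, (if c < v then A else B) = (1 - c) * A + c * B := by
  have h : ∀ v : ℝ, (if c < v then A else B) =
      (Set.Ioi c).indicator (fun _ => A - B) v + B := by
    intro v
    by_cases hv : c < v <;> simp [hv]
  have hs : Set.Ioi c ∩ Set.Ioo 0 1 = Set.Ioo c 1 := by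
    ext v; simp only [Set.mem_inter_iff, Set.mem_Ioi, Set.mem_Ioo]
    constructor
    · rintro ⟨a, b, d⟩; exact ⟨a, d⟩
    · rintro ⟨a, b⟩; exact ⟨a, by linarith, b⟩
  simp_rw [h]
  rw [integral_add ((integrable_const _).indicator measurableSet_Ioi) (integrable_const _),
    integral_indicator_const _ measurableSet_Ioi, integral_const]
  simp only [measureReal_def, Measure.restrict_apply measurableSet_Ioi, hs, Real.volume_Ioo,
    measure_univ, smul_eq_mul]
  rw [ENNReal.toReal_ofReal (by linarith)]
  simp
  ring

theorem integral_Ioo_ite' {p : ℝ} (h0 : 0 ≤ p) (h1 : p ≤ 1) (b : Bool) :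
    ∫ v in Set.Ioo (0 : ℝ) 1, (if decide (v < p) = b then (1 : ℝ) else 0) = bitMass p b := by
  have h := integral_Ioo_ite h0 h1 (if b then 0 else 1) (if b then 1 else 0)
  have h2 : ∫ v in Set.Ioo (0 : ℝ) 1, (if decide (v < p) = b then (1 : ℝ) else 0) =
      ∫ v in Set.Ioo (0 : ℝ) 1, (if p < v then (if b then 0 else 1) else (if b then 1 else 0)) := by
    refine integral_congr_ae ?_
    -- The two integrands may disagree at v = p, a null set.
    have : ∀ᵐ v : ℝ ∂((volume : Measure ℝ).restrict (Set.Ioo 0 1)), v ≠ p :=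
      ae_restrict_of_ae (Measure.ae_ne volume p)
    filter_upwards [this] with v hv
    rcases lt_or_gt_of_ne hv with hv | hv
    · cases b <;> simp [hv, hv.not_gt]
    · cases b <;> simp [hv, hv.not_gt]
  rw [h2, h]
  cases b <;> simp [bitMass]

theorem measurable_rerandomize (p ε : ℝ) :
    Measurable fun x : (E → Bool) × (E → ℝ) × (E → ℝ) => rerandomize p ε x.1 x.2.1 x.2.2 := by
  refine measurable_pi_lambda _ fun e => ?_
  refine Measurable.ite ?_ ((measurable_pi_apply e).comp measurable_fst) ?_
  · exact measurableSet_lt measurable_const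
      ((measurable_pi_apply e).comp (measurable_fst.comp measurable_snd))
  · have h : Measurable fun v : ℝ => decide (v < p) := by
      refine measurable_to_bool ?_
      convert (measurableSet_Iio : MeasurableSet (Set.Iio p)) using 1
      ext v; simp
    exact h.comp ((measurable_pi_apply e).comp (measurable_snd.comp measurable_snd))

/-- Given ω, the bits of ω_ε are independent, so the transition probability from ω to η factorizes
over the coordinates. -/
theorem integral_rerandomize {p ε : ℝ} (h0 : 0 ≤ p) (h1 : p ≤ 1) (hε0 : 0 ≤ ε) (hε1 : ε ≤ 1)
    (ω η : E → Bool) :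
    ∫ x : (E → ℝ) × (E → ℝ), (if rerandomize p ε ω x.1 x.2 = η then (1 : ℝ) else 0)
        ∂((uniformMeasure E).prod (uniformMeasure E)) =
      ∏ e, ((1 - ε) * (if ω e = η e then 1 else 0) + ε * bitMass p (η e)) := by
  let k : E → ℝ → ℝ → ℝ := fun e u v =>
    if (if ε < u then ω e else decide (v < p)) = η e then 1 else 0
  have hk : ∀ U V : E → ℝ, (if rerandomize p ε ω U V = η then (1 : ℝ) else 0) =
      ∏ e, k e (U e) (V e) := by
    intro U V
    rw [Finset.prod_ite_zero]
    simp [funext_iff, rerandomize]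
  have hm : Measurable fun x : (E → ℝ) × (E → ℝ) => rerandomize p ε ω x.1 x.2 :=
    (measurable_rerandomize p ε).comp (measurable_const.prodMk measurable_id)
  have hi : Integrable (fun x : (E → ℝ) × (E → ℝ) =>
      (if rerandomize p ε ω x.1 x.2 = η then (1 : ℝ) else 0))
      ((uniformMeasure E).prod (uniformMeasure E)) := by
    refine Integrable.of_bound (C := 1) (Measurable.aestronglyMeasurable ?_) ?_
    · exact (Measurable.of_discrete (f := fun ζ : E → Bool => if ζ = η then (1 : ℝ) else 0)).comp hm
    · refine Eventually.of_forall fun x => ?_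
      split_ifs <;> simp
  rw [integral_prod _ hi]
  simp only [hk]
  have hin : ∀ U : E → ℝ, ∫ V, ∏ e, k e (U e) (V e) ∂(uniformMeasure E) =
      ∏ e, ∫ v in Set.Ioo (0 : ℝ) 1, k e (U e) v := fun U =>
    integral_fintype_prod_eq_prod (fun e v => k e (U e) v)
  simp_rw [hin]
  have hout : ∫ U, (∏ e, ∫ v in Set.Ioo (0 : ℝ) 1, k e (U e) v) ∂(uniformMeasure E) =
      ∏ e, ∫ u in Set.Ioo (0 : ℝ) 1, ∫ v in Set.Ioo (0 : ℝ) 1, k e u v :=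
    integral_fintype_prod_eq_prod (fun e u => ∫ v in Set.Ioo (0 : ℝ) 1, k e u v)
  rw [hout]
  refine Finset.prod_congr rfl fun e _ => ?_
  rw [← integral_Ioo_ite hε0 hε1]
  refine integral_congr_ae (Eventually.of_forall fun u => ?_)
  by_cases hu : ε < u
  · simp [k, hu]
  · simp only [k, hu, if_false]
    exact integral_Ioo_ite' h0 h1 _

theorem noisyExpect_eq_sum {p ε : ℝ} (h0 : 0 < p) (h1 : p < 1) (hε0 : 0 ≤ ε) (hε1 : ε ≤ 1)
    (f g : (E → Bool) → ℝ) :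
    noisyExpect p ε f g = ∑ S : Finset E, (1 - ε) ^ S.card * (fhat p f S * fhat p g S) := by
  have hm := measurable_rerandomize (E := E) p ε
  have hi : ∀ (F : (E → Bool) → (E → Bool) → ℝ), Integrable
      (fun x : (E → Bool) × (E → ℝ) × (E → ℝ) => F x.1 (rerandomize p ε x.1 x.2.1 x.2.2))
      ((bitMeasure E p).prod ((uniformMeasure E).prod (uniformMeasure E))) := by
    intro F
    refine Integrable.of_bound (C := ∑ ω, ∑ η, |F ω η|) (Measurable.aestronglyMeasurable ?_) ?_
    · exact (Measurable.of_discrete (f := fun ζ : (E → Bool) × (E → Bool) => F ζ.1 ζ.2)).comp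
        (measurable_fst.prodMk hm)
    · refine Eventually.of_forall fun x => ?_
      rw [Real.norm_eq_abs]
      refine le_trans ?_ (Finset.single_le_sum (f := fun ω => ∑ η, |F ω η|)
        (fun ω _ => Finset.sum_nonneg fun _ _ => abs_nonneg _) (Finset.mem_univ x.1))
      exact Finset.single_le_sum (f := fun η => |F x.1 η|) (fun _ _ => abs_nonneg _)
        (Finset.mem_univ _)
  rw [sum_pow_card_mul_fhat_kernel h0 h1, noisyExpect, integral_prod _ (hi fun ω η => f ω * g η),
    integral_bitMeasure h0.le h1.le]
  refine Finset.sum_congr rfl fun ω _ => ?_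
  dsimp only
  rw [integral_const_mul]
  congr 2
  have hg : ∀ y : (E → ℝ) × (E → ℝ), g (rerandomize p ε ω y.1 y.2) =
      ∑ η, g η * (if rerandomize p ε ω y.1 y.2 = η then (1 : ℝ) else 0) := by
    intro y; simp
  simp_rw [hg]
  have hm' : Measurable fun y : (E → ℝ) × (E → ℝ) => rerandomize p ε ω y.1 y.2 :=
    hm.comp (measurable_const.prodMk measurable_id)
  rw [integral_finsetSum]
  · refine Finset.sum_congr rfl fun η _ => ?_
    rw [integral_const_mul, integral_rerandomize h0.le h1.le hε0 hε1]
  · intro η _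
    refine Integrable.const_mul (Integrable.of_bound (C := 1)
      (Measurable.aestronglyMeasurable ?_) ?_) _
    · exact (Measurable.of_discrete (f := fun ζ : E → Bool => if ζ = η then (1 : ℝ) else 0)).comp
        hm'
    · refine Eventually.of_forall fun x => ?_
      split_ifs <;> simp

/-- The noise covariance of `f`: the part of the noise expectation on nonempty Fourier levels. -/
theorem noisyExpect_sub_sq {p ε : ℝ} (h0 : 0 < p) (h1 : p < 1) (hε0 : 0 ≤ ε) (hε1 : ε ≤ 1)
    (f : (E → Bool) → ℝ) :
    noisyExpect p ε f f - expect p f ^ 2 =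
      ∑ S ∈ (Finset.univ : Finset (Finset E)).erase ∅, (1 - ε) ^ S.card * fhat p f S ^ 2 := by
  rw [noisyExpect_eq_sum h0 h1 hε0 hε1, expect, integral_bitMeasure h0.le h1.le, ← fhat_empty,
    ← Finset.add_sum_erase _ _ (Finset.mem_univ (∅ : Finset E))]
  simp [pow_two]

/-- Group the sets by size and use ∑ k ρ^k = ρ/(1-ρ)² ≤ 1/ε² at ρ = 1 - ε. -/
theorem noise_covariance_le {p ε δ : ℝ} (hε0 : 0 < ε) (hε1 : ε ≤ 1) (hδ : 0 ≤ δ)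
    (f : (E → Bool) → ℝ)
    (hf : ∀ k : ℕ, 1 ≤ k →
      ∑ S ∈ Finset.powersetCard k Finset.univ, fhat p f S ^ 2 ≤ k * δ) :
    ∑ S ∈ (Finset.univ : Finset (Finset E)).erase ∅, (1 - ε) ^ S.card * fhat p f S ^ 2
      ≤ δ / ε ^ 2 := by
  have hρ0 : 0 ≤ 1 - ε := by linarith
  have hρ : ‖1 - ε‖ < 1 := by rw [Real.norm_eq_abs, abs_of_nonneg hρ0]; linarith
  have hs := hasSum_coe_mul_geometric_of_norm_lt_one hρ
  have h1 : ∑ S ∈ (Finset.univ : Finset (Finset E)).erase ∅, (1 - ε) ^ S.card * fhat p f S ^ 2 ≤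
      ∑ k ∈ Finset.range (Fintype.card E + 1), (k : ℝ) * (1 - ε) ^ k * δ := by
    rw [← Finset.sum_fiberwise_of_maps_to (t := Finset.range (Fintype.card E + 1))
      (g := Finset.card) (fun S _ => Finset.mem_range.mpr (Nat.lt_succ_of_le S.card_le_univ))]
    refine Finset.sum_le_sum fun k _ => ?_
    rcases Nat.eq_zero_or_pos k with rfl | hk
    · rw [Finset.sum_eq_zero]
      · simp
      · intro S hS
        simp only [Finset.mem_filter, Finset.mem_erase, Finset.card_eq_zero] at hS
        exact absurd hS.2 hS.1.1
    · have : ∑ S ∈ (Finset.univ : Finset (Finset E)).erase ∅ with S.card = k,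
          (1 - ε) ^ S.card * fhat p f S ^ 2 ≤
          ∑ S ∈ Finset.powersetCard k Finset.univ, (1 - ε) ^ k * fhat p f S ^ 2 := by
        rw [Finset.sum_congr rfl fun S hS => by rw [(Finset.mem_filter.mp hS).2]]
        refine Finset.sum_le_sum_of_subset_of_nonneg ?_ fun S _ _ => by positivity
        intro S hS
        simpa [Finset.mem_powersetCard] using (Finset.mem_filter.mp hS).2
      refine this.trans ?_
      rw [← Finset.mul_sum]
      refine (mul_le_mul_of_nonneg_left (hf k hk) (pow_nonneg hρ0 k)).trans (le_of_eq ?_)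
      ring
  refine h1.trans ?_
  rw [← Finset.sum_mul]
  have h2 := sum_le_hasSum (Finset.range (Fintype.card E + 1))
    (fun k _ => mul_nonneg (Nat.cast_nonneg k) (pow_nonneg hρ0 k)) hs
  refine (mul_le_mul_of_nonneg_right h2 hδ).trans ?_
  rw [sub_sub_cancel, div_mul_eq_mul_div]
  gcongr
  nlinarith

/-- If `f` is uniformly close to a function with small low-level Fourier weight, its noise
covariance is small. -/
theorem noisyExpect_sub_sq_le {p ε δ η : ℝ} (h0 : 0 < p) (h1 : p < 1) (hε0 : 0 < ε) (hε1 : ε ≤ 1)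
    (hδ : 0 ≤ δ) (f g : (E → Bool) → ℝ) (hfg : ∀ ω, |f ω - g ω| ≤ η)
    (hg : ∀ k : ℕ, 1 ≤ k →
      ∑ S ∈ Finset.powersetCard k Finset.univ, fhat p g S ^ 2 ≤ k * δ) :
    noisyExpect p ε f f - expect p f ^ 2 ≤ 2 * (δ / ε ^ 2) + 2 * η ^ 2 := by
  have hρ0 : 0 ≤ 1 - ε := by linarith
  have hg' := noise_covariance_le hε0 hε1 hδ g hg
  have hd : ∑ S : Finset E, fhat p (fun ω => f ω - g ω) S ^ 2 ≤ η ^ 2 := by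
    rw [parseval h0 h1, ← ex_const (E := E) p (η ^ 2)]
    refine ex_mono h0.le h1.le fun ω => ?_
    exact sq_le_sq' (abs_le.mp (hfg ω)).1 (abs_le.mp (hfg ω)).2
  rw [noisyExpect_sub_sq h0 h1 hε0.le hε1]
  have h2 : ∑ S ∈ (Finset.univ : Finset (Finset E)).erase ∅, (1 - ε) ^ S.card * fhat p f S ^ 2 ≤
      2 * (∑ S ∈ (Finset.univ : Finset (Finset E)).erase ∅, (1 - ε) ^ S.card * fhat p g S ^ 2) +
      2 * ∑ S ∈ (Finset.univ : Finset (Finset E)).erase ∅, fhat p (fun ω => f ω - g ω) S ^ 2 := by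
    rw [Finset.mul_sum, Finset.mul_sum, ← Finset.sum_add_distrib]
    refine Finset.sum_le_sum fun S _ => ?_
    rw [fhat_sub]
    have ha : (1 - ε) ^ S.card ≤ 1 := pow_le_one₀ hρ0 (by linarith)
    have hb : 0 ≤ (1 - ε) ^ S.card := pow_nonneg hρ0 _
    have hc := mul_le_mul_of_nonneg_right ha (sq_nonneg (fhat p f S - fhat p g S))
    -- The identity 2y² + 2(x-y)² - x² = (x-2y)² gives x² ≤ 2y² + 2(x-y)².
    nlinarith [mul_nonneg hb (sq_nonneg (fhat p f S - 2 * fhat p g S))]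
  have h3 : ∑ S ∈ (Finset.univ : Finset (Finset E)).erase ∅, fhat p (fun ω => f ω - g ω) S ^ 2 ≤
      ∑ S : Finset E, fhat p (fun ω => f ω - g ω) S ^ 2 :=
    Finset.sum_le_sum_of_subset_of_nonneg (Finset.erase_subset _ _) fun _ _ _ => sq_nonneg _
  linarith

theorem noisyExpect_sub_sq_nonneg {p ε : ℝ} (h0 : 0 < p) (h1 : p < 1) (hε0 : 0 ≤ ε) (hε1 : ε ≤ 1)
    (f : (E → Bool) → ℝ) : 0 ≤ noisyExpect p ε f f - expect p f ^ 2 := by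
  rw [noisyExpect_sub_sq h0 h1 hε0 hε1]
  exact Finset.sum_nonneg fun S _ =>
    mul_nonneg (pow_nonneg (by linarith) _) (sq_nonneg _)

end Noise

/-! ### Truncated mean component size via a ghost set -/

section Ghost

theorem ex_all_false {E : Type} [Fintype E] [DecidableEq E] (p : ℝ) (A : Finset E) :
    ex p (fun ω : E → Bool => if ∀ e ∈ A, ω e = false then (1 : ℝ) else 0) =
      (1 - p) ^ A.card := by
  have h := ex_prod_const_mul p A (fun b => if b = false then (1 : ℝ) else 0) (fun _ => 1)
    (fun _ _ _ _ => rfl)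
  rw [ex_const] at h
  simp only [mul_one] at h
  simp_rw [Finset.prod_ite_zero, Finset.prod_const_one] at h
  rw [h]; simp

/-- A random set of bits that does not depend on these bits consists of zeros with the
conditional probability suggested by its size. -/
theorem ex_random_all_false {E : Type} [Fintype E] [DecidableEq E] (p : ℝ)
    (B : (E → Bool) → Finset E) (hB : ∀ ω, ∀ e ∈ B ω, ∀ b, B (Function.update ω e b) = B ω) :
    ex p (fun ω => if ∀ e ∈ B ω, ω e = false then (1 : ℝ) else 0) =
      ex p (fun ω => (1 - p) ^ (B ω).card) := by
  -- Split according to the value A of `B`: the event `B ω = A` does not depend on the bits of A,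
  -- which can then be averaged separately.
  have h1 : ∀ φ : (E → Bool) → Finset E → ℝ, (fun ω => φ ω (B ω)) =
      fun ω => ∑ A, φ ω A * if B ω = A then 1 else 0 := by
    intro φ; funext ω; simp
  rw [h1 fun ω A => if ∀ e ∈ A, ω e = false then (1 : ℝ) else 0, h1 fun _ A => (1 - p) ^ A.card,
    ex_sum, ex_sum]
  refine Finset.sum_congr rfl fun A _ => ?_
  rw [ex_const_mul]
  have h := ex_prod_const_mul p A (fun b => if b = false then (1 : ℝ) else 0)
    (fun ω => if B ω = A then (1 : ℝ) else 0) (by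
      intro e he ω b
      have : B (Function.update ω e b) = A ↔ B ω = A := by
        constructor
        · intro hA
          have := hB (Function.update ω e b) e (hA ▸ he) (ω e)
          rw [Function.update_idem, Function.update_eq_self] at this
          rw [this, hA]
        · intro hA
          rw [hB ω e (hA ▸ he) b, hA]
      simp only [this])
  simp_rw [Finset.prod_ite_zero, Finset.prod_const_one] at h
  rw [h]; simp

variable {n : ℕ}

/-- The edge between two distinct vertices. -/
def edge {v w : Fin n} (h : v ≠ w) : KEdge n := ⟨s(v, w), by simpa using h⟩

theorem graphOf_adj (ω : KEdge n → Bool) (v w : Fin n) :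
    (graphOf ω).Adj v w ↔ ∃ h : v ≠ w, ω (edge h) = true := by
  simp only [graphOf, SimpleGraph.fromEdgeSet_adj, Set.mem_ofPred_eq]
  constructor
  · rintro ⟨⟨h, hω⟩, hne⟩
    exact ⟨hne, hω⟩
  · rintro ⟨h, hω⟩
    exact ⟨⟨(edge h).2, hω⟩, h⟩

open Classical in
/-- The vertex set of the component of `v`. -/
def cluster (ω : KEdge n → Bool) (v : Fin n) : Finset (Fin n) :=
  Finset.univ.filter fun w => (graphOf ω).Reachable v w

theorem mem_cluster {ω : KEdge n → Bool} {v w : Fin n} :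
    w ∈ cluster ω v ↔ (graphOf ω).Reachable v w := by
  simp [cluster]

/-- The graph without the edges at `v`. -/
def isolate (ω : KEdge n → Bool) (v : Fin n) : SimpleGraph (Fin n) where
  Adj x y := (graphOf ω).Adj x y ∧ x ≠ v ∧ y ≠ v
  symm := ⟨fun _ _ h => ⟨h.1.symm, h.2.2, h.2.1⟩⟩
  loopless := ⟨fun _ h => h.1.ne rfl⟩

theorem isolate_le (ω : KEdge n → Bool) (v : Fin n) : isolate ω v ≤ graphOf ω :=
  fun _ _ h => h.1

theorem isolate_update (ω : KEdge n → Bool) {v : Fin n} {e : KEdge n} (he : v ∈ e.1) (b : Bool) :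
    isolate (Function.update ω e b) v = isolate ω v := by
  ext x y
  simp only [isolate, graphOf_adj]
  constructor <;>
  · rintro ⟨⟨h, hω⟩, hx, hy⟩
    refine ⟨⟨h, ?_⟩, hx, hy⟩
    have hne : edge h ≠ e := by
      rintro rfl
      rcases Sym2.mem_iff.mp he with h' | h'
      · exact hx h'.symm
      · exact hy h'.symm
    simpa [Function.update_of_ne hne] using hω

open Classical in
/-- The vertices other than `v` that are joined to the ghost set `Y` without using `v`. -/
def ghostSet (Y : Fin n → Bool) (v : Fin n) (ω : KEdge n → Bool) : Finset (Fin n) :=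
  Finset.univ.filter fun w => w ≠ v ∧ ∃ y, y ≠ v ∧ Y y = true ∧ (isolate ω v).Reachable w y

open Classical in
/-- The edges between `v` and the vertices joined to the ghost set. -/
def ghostEdges (Y : Fin n → Bool) (v : Fin n) (ω : KEdge n → Bool) : Finset (KEdge n) :=
  Finset.univ.filter fun e => ∃ w ∈ ghostSet Y v ω, e.1 = s(v, w)

theorem card_ghostEdges_le (Y : Fin n → Bool) (v : Fin n) (ω : KEdge n → Bool) :
    (ghostEdges Y v ω).card ≤ (ghostSet Y v ω).card := by
  classical
  rw [← Finset.card_image_of_injective _ (Subtype.val_injective (p := (· ∈ _)))]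
  refine (Finset.card_le_card ?_).trans
    (Finset.card_image_le (s := ghostSet Y v ω) (f := fun w => s(v, w)))
  intro e he
  simp only [Finset.mem_image, ghostEdges, Finset.mem_filter, Finset.mem_univ, true_and] at he ⊢
  obtain ⟨e, ⟨w, hw, h⟩, rfl⟩ := he
  exact ⟨w, hw, h.symm⟩

theorem ghostEdges_update (Y : Fin n → Bool) (v : Fin n) (ω : KEdge n → Bool) :
    ∀ e ∈ ghostEdges Y v ω, ∀ b, ghostEdges Y v (Function.update ω e b) = ghostEdges Y v ω := by
  intro e he b
  have hv : v ∈ e.1 := by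
    simp only [ghostEdges, Finset.mem_filter, Finset.mem_univ, true_and] at he
    obtain ⟨w, _, h⟩ := he
    rw [h]; exact Sym2.mem_mk_left v w
  have h : ghostSet Y v (Function.update ω e b) = ghostSet Y v ω := by
    ext w
    simp only [ghostSet, Finset.mem_filter, isolate_update ω hv b]
  simp only [ghostEdges, h]

/-- If no edge joins `v` to the vertices joined to the ghost set, and `v` is not in it, then
the component of `v` avoids the ghost set. -/
theorem cluster_avoids {Y : Fin n → Bool} {v : Fin n} {ω : KEdge n → Bool} (hv : Y v = false)
    (h : ∀ e ∈ ghostEdges Y v ω, ω e = false) : ∀ w ∈ cluster ω v, Y w = false := by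
  have hcl : ∀ w, (graphOf ω).Reachable v w → w ∉ ghostSet Y v ω := by
    intro w hw
    rw [SimpleGraph.reachable_iff_reflTransGen] at hw
    induction hw with
    | refl => simp [ghostSet]
    | @tail x y hvx hxy ih =>
      intro hy
      by_cases hxv : x = v
      · subst hxv
        obtain ⟨hne, hω⟩ := (graphOf_adj ω _ _).mp hxy
        have := h (edge hne) (by
          simp only [ghostEdges, Finset.mem_filter, Finset.mem_univ, true_and]
          exact ⟨y, hy, rfl⟩)
        rw [this] at hω
        exact absurd hω (by simp)
      · simp only [ghostSet, Finset.mem_filter, Finset.mem_univ, true_and] at hy ih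
        obtain ⟨hyv, z, hz, hYz, hr⟩ := hy
        have ha : (isolate ω v).Adj x y := ⟨hxy, hxv, hyv⟩
        exact ih ⟨hxv, z, hz, hYz, ha.reachable.trans hr⟩
  intro w hw
  by_contra hY
  rw [Bool.not_eq_false] at hY
  have hwv : w ≠ v := by rintro rfl; rw [hv] at hY; exact absurd hY (by simp)
  refine hcl w (mem_cluster.mp hw) ?_
  simp only [ghostSet, Finset.mem_filter, Finset.mem_univ, true_and]
  exact ⟨hwv, w, hwv, hY, SimpleGraph.Reachable.refl w⟩

/-- Connections that avoid v are connections in the whole graph. The bound by full components is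
what makes the estimate on `hitProb` close on itself. -/
theorem card_ghostSet_le (Y : Fin n → Bool) (v : Fin n) (ω : KEdge n → Bool) :
    ((ghostSet Y v ω).card : ℝ) ≤ ∑ w ∈ Finset.univ.erase v,
      (1 - if ∀ y ∈ cluster ω w, Y y = false then (1 : ℝ) else 0) := by
  classical
  have h : ghostSet Y v ω ⊆
      (Finset.univ.erase v).filter fun w => ¬ ∀ y ∈ cluster ω w, Y y = false := by
    intro w hw
    simp only [ghostSet, Finset.mem_filter, Finset.mem_univ, true_and] at hw
    obtain ⟨hwv, y, -, hY, hr⟩ := hw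
    simp only [Finset.mem_filter, Finset.mem_erase, Finset.mem_univ, and_true]
    refine ⟨hwv, fun hc => ?_⟩
    have := hc y (mem_cluster.mpr (hr.mono (isolate_le ω v)))
    rw [hY] at this
    exact absurd this (by simp)
  have h2 : ∀ w : Fin n, (1 - if ∀ y ∈ cluster ω w, Y y = false then (1 : ℝ) else 0) =
      if ¬ ∀ y ∈ cluster ω w, Y y = false then (1 : ℝ) else 0 := by
    intro w; split_ifs <;> norm_num
  simp_rw [h2]
  rw [← Finset.sum_filter, Finset.sum_const, nsmul_eq_mul, mul_one]
  exact_mod_cast Finset.card_le_card h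

/-- The probability that the component of `v` meets an independent Bernoulli set of
vertices with parameter `γ`. -/
def hitProb (n : ℕ) (p γ : ℝ) (v : Fin n) : ℝ :=
  1 - ex p fun ω : KEdge n → Bool => (1 - γ) ^ (cluster ω v).card

theorem ex_ghost (p γ : ℝ) (v : Fin n) :
    ex γ (fun Y : Fin n → Bool => ex p fun ω : KEdge n → Bool =>
      if ∀ w ∈ cluster ω v, Y w = false then (1 : ℝ) else 0) = 1 - hitProb n p γ v := by
  rw [ex_comm, hitProb, sub_sub_cancel]
  congr 1; funext ω
  convert ex_all_false γ (cluster ω v)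

/-- The rate 1/(n-1) matches the n-1 vertices other than v, so the later exponent averages to at
most θ without an error term. -/
theorem exp_neg_le_one_sub (hn : 2 ≤ n) : Real.exp (-(1 / ((n : ℝ) - 1))) ≤ 1 - 1 / n := by
  have hn' : (2 : ℝ) ≤ n := by exact_mod_cast hn
  have h := Real.add_one_le_exp (1 / ((n : ℝ) - 1))
  have h1 : (0 : ℝ) < n - 1 := by linarith
  rw [Real.exp_neg]
  refine inv_le_of_inv_le₀ (by rw [sub_pos, div_lt_one] <;> linarith) (le_trans (le_of_eq ?_) h)
  field_simp
  ring

/-- The component of v avoids the ghost set if v is not a ghost, which fails with probability γ, and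
no edge joins v to `ghostSet`. Given the graph without v, the latter has probability at least (1 -
1/n)^|`ghostSet`|, and convexity brings in the mean size, at most (n-1)θ. -/
theorem one_sub_hitProb_ge (hn : 2 ≤ n) {γ θ : ℝ} (hγ0 : 0 ≤ γ) (hγ1 : γ ≤ 1)
    (hθ : ∀ w : Fin n, hitProb n (1 / n) γ w ≤ θ) (v : Fin n) :
    Real.exp (-θ) - γ ≤ 1 - hitProb n (1 / n) γ v := by
  have hn' : (2 : ℝ) ≤ n := by exact_mod_cast hn
  have hn1 : (0 : ℝ) < n - 1 := by linarith
  set p : ℝ := 1 / n with hp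
  have hp0 : 0 ≤ p := by positivity
  have hp1 : p ≤ 1 := by rw [hp, div_le_one] <;> linarith
  have hpt : ∀ Y : Fin n → Bool,
      Real.exp (-θ) * (1 + θ - 1 / (n - 1) * ∑ w ∈ Finset.univ.erase v,
        (1 - ex p fun ω : KEdge n → Bool =>
          if ∀ y ∈ cluster ω w, Y y = false then (1 : ℝ) else 0)) -
        (if Y v = true then (1 : ℝ) else 0) ≤
      ex p fun ω : KEdge n → Bool => if ∀ w ∈ cluster ω v, Y w = false then (1 : ℝ) else 0 := by
    intro Y
    have a1 : ex p (fun ω : KEdge n → Bool =>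
        (if ∀ e ∈ ghostEdges Y v ω, ω e = false then (1 : ℝ) else 0) -
          if Y v = true then (1 : ℝ) else 0) ≤
        ex p fun ω : KEdge n → Bool =>
          if ∀ w ∈ cluster ω v, Y w = false then (1 : ℝ) else 0 := by
      refine ex_mono hp0 hp1 fun ω => ?_
      by_cases hY : Y v = true
      · rw [if_pos hY]
        split_ifs <;> norm_num
      · rw [if_neg hY, sub_zero]
        by_cases h : ∀ e ∈ ghostEdges Y v ω, ω e = false
        · rw [if_pos h, if_pos (cluster_avoids (by simpa using hY) h)]
        · rw [if_neg h]; split_ifs <;> norm_num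
    rw [ex_sub, ex_const, ex_random_all_false p _ (ghostEdges_update Y v)] at a1
    refine le_trans (sub_le_sub_right ?_ _) a1
    have a2 : ∀ ω : KEdge n → Bool, Real.exp (-θ) * (1 + θ - 1 / (n - 1) *
        ∑ w ∈ Finset.univ.erase v,
          (1 - if ∀ y ∈ cluster ω w, Y y = false then (1 : ℝ) else 0)) ≤
        (1 - p) ^ (ghostEdges Y v ω).card := by
      intro ω
      have b1 : (1 - p) ^ (ghostSet Y v ω).card ≤ (1 - p) ^ (ghostEdges Y v ω).card :=
        pow_le_pow_of_le_one (by linarith) (by linarith) (card_ghostEdges_le Y v ω)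
      refine le_trans ?_ b1
      refine le_trans ?_ (pow_le_pow_left₀ (Real.exp_pos _).le (exp_neg_le_one_sub hn) _)
      rw [← Real.exp_nat_mul]
      -- Jensen's inequality in explicit form: the tangent line of exp at -θ is affine in the
      -- cardinality and can be averaged over ω and then over Y.
      have b2 := Real.add_one_le_exp (θ + (ghostSet Y v ω).card * -(1 / ((n : ℝ) - 1)))
      have b3 : Real.exp ((ghostSet Y v ω).card * -(1 / ((n : ℝ) - 1))) = Real.exp (-θ) *
          Real.exp (θ + (ghostSet Y v ω).card * -(1 / ((n : ℝ) - 1))) := by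
        rw [← Real.exp_add]; congr 1; ring
      rw [b3]
      refine mul_le_mul_of_nonneg_left (le_trans ?_ b2) (Real.exp_pos _).le
      have b4 := mul_le_mul_of_nonneg_left (card_ghostSet_le Y v ω)
        (by positivity : 0 ≤ 1 / ((n : ℝ) - 1))
      linarith
    refine le_trans (le_of_eq ?_) (ex_mono hp0 hp1 a2)
    rw [ex_const_mul, ex_sub, ex_const_mul, ex_sum, ex_const]
    simp_rw [ex_sub, ex_const]
  have h2 := ex_mono hγ0 hγ1 hpt
  rw [ex_ghost, ex_sub, ex_coord, ex_const_mul, ex_sub, ex_const_mul, ex_sum, ex_const] at h2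
  simp_rw [ex_sub, ex_const, ex_ghost, sub_sub_cancel] at h2
  refine le_trans (sub_le_sub_right ?_ γ) h2
  have h3 : ∑ w ∈ Finset.univ.erase v, hitProb n p γ w ≤ (n - 1) * θ := by
    refine (Finset.sum_le_sum fun w _ => hθ w).trans (le_of_eq ?_)
    rw [Finset.sum_const, Finset.card_erase_of_mem (Finset.mem_univ v), Finset.card_univ,
      Fintype.card_fin, nsmul_eq_mul, Nat.cast_sub (by omega), Nat.cast_one]
  have h4 := mul_le_mul_of_nonneg_left h3 (by positivity : 0 ≤ 1 / ((n : ℝ) - 1))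
  rw [← mul_assoc, one_div_mul_cancel hn1.ne', one_mul] at h4
  nlinarith [Real.exp_pos (-θ)]

/-- At a vertex with the largest value θ, 1-θ ≥ exp(-θ) - γ ≥ (1-θ/2)² - γ, so θ²/4 ≤ γ. The
square-root behaviour reflects criticality. -/
theorem hitProb_le (hn : 2 ≤ n) {γ : ℝ} (hγ0 : 0 ≤ γ) (hγ1 : γ ≤ 1) (v : Fin n) :
    hitProb n (1 / n) γ v ≤ 2 * √γ := by
  have : Nonempty (Fin n) := ⟨v⟩
  obtain ⟨u, hu⟩ := Finite.exists_max (hitProb n (1 / n) γ)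
  refine (hu v).trans ?_
  set θ := hitProb n (1 / n) γ u
  have hn' : (2 : ℝ) ≤ n := by exact_mod_cast hn
  have hp0 : (0 : ℝ) ≤ 1 / n := by positivity
  have hp1 : (1 : ℝ) / n ≤ 1 := by rw [div_le_one] <;> linarith
  have h := one_sub_hitProb_ge hn hγ0 hγ1 hu u
  have hθ1 : θ ≤ 1 := sub_le_self _ (ex_nonneg hp0 hp1 fun ω => pow_nonneg (by linarith) _)
  have h1 := Real.add_one_le_exp (-θ / 2)
  have h2 : Real.exp (-θ) = Real.exp (-θ / 2) ^ 2 := by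
    rw [← Real.exp_nat_mul]; congr 1; push_cast; ring
  have h3 : (1 - θ / 2) ^ 2 ≤ Real.exp (-θ) := by
    rw [h2]
    exact pow_le_pow_left₀ (by linarith) (by linarith) 2
  have h4 : (θ / 2) ^ 2 ≤ γ := by
    change Real.exp (-θ) - γ ≤ 1 - θ at h
    nlinarith
  have := Real.le_sqrt_of_sq_le h4
  linarith

/-- The truncated mean of the component size in the critical random graph. -/
theorem ex_min_cluster_le (hn : 2 ≤ n) {M : ℕ} (hM : 1 ≤ M) (v : Fin n) :
    ex (1 / (n : ℝ)) (fun ω : KEdge n → Bool => (min (cluster ω v).card M : ℝ)) ≤ 4 * √M := by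
  have hn' : (2 : ℝ) ≤ n := by exact_mod_cast hn
  have hp0 : (0 : ℝ) ≤ 1 / n := by positivity
  have hp1 : (1 : ℝ) / n ≤ 1 := by rw [div_le_one] <;> linarith
  have hM' : (1 : ℝ) ≤ M := by exact_mod_cast hM
  have hM0 : (0 : ℝ) < M := by linarith
  set γ : ℝ := 1 / M with hγ
  have hγ0 : 0 ≤ γ := by positivity
  have hγ1 : γ ≤ 1 := by rw [hγ, div_le_one] <;> linarith
  have hpt : ∀ ω : KEdge n → Bool, (min (cluster ω v).card M : ℝ) ≤
      2 * M * (1 - (1 - γ) ^ (cluster ω v).card) := by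
    intro ω
    set x := min (cluster ω v).card M with hx
    have hxM : (x : ℝ) ≤ M := by exact_mod_cast min_le_right _ _
    have e1 : (1 - γ) ^ (cluster ω v).card ≤ (1 - γ) ^ x :=
      pow_le_pow_of_le_one (by linarith) (by linarith) (min_le_left _ _)
    have e2 : 1 + x * γ ≤ (1 + γ) ^ x := one_add_mul_le_pow (by linarith) x
    have e3 : (1 - γ) ^ x * (1 + γ) ^ x ≤ 1 := by
      rw [← mul_pow]
      exact pow_le_one₀ (by nlinarith) (by nlinarith)
    have e4 : (1 - γ) ^ x * (1 + x * γ) ≤ 1 :=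
      (mul_le_mul_of_nonneg_left e2 (pow_nonneg (by linarith) x)).trans e3
    have e5 : (x : ℝ) = M * (x * γ) := by
      rw [hγ, mul_left_comm, mul_one_div_cancel hM0.ne', mul_one]
    have e6 : 0 ≤ (x : ℝ) * γ := mul_nonneg (Nat.cast_nonneg x) hγ0
    have e7 : (x : ℝ) * γ ≤ 1 := by rw [hγ, mul_one_div, div_le_one hM0]; exact hxM
    -- With y = xγ ≤ 1, `e4` gives (1-γ)^x ≤ 1/(1+y), and (1-y/2)(1+y) ≥ 1 on [0,1].
    have e8 : (x : ℝ) * γ ≤ 2 * (1 - (1 - γ) ^ x) := by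
      by_contra hc
      have : 1 - x * γ / 2 < (1 - γ) ^ x := by linarith
      nlinarith [mul_lt_mul_of_pos_right this (by linarith : 0 < 1 + x * γ)]
    rw [← Nat.cast_min, ← hx]
    nlinarith
  refine (ex_mono hp0 hp1 hpt).trans ?_
  rw [ex_const_mul, ex_sub, ex_const]
  have h := hitProb_le hn hγ0 hγ1 v
  rw [hitProb] at h
  have h2 : √γ = √M / M := by
    rw [hγ, Real.sqrt_div zero_le_one, Real.sqrt_one, Real.sqrt_div_self', one_div]
  rw [h2] at h
  refine (mul_le_mul_of_nonneg_left h (by positivity)).trans (le_of_eq ?_)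
  field_simp
  ring

end Ghost

/-! ### Truncated exploration from seeds -/

section Exploration

variable {n : ℕ}

open Classical in
/-- A vertex set together with its neighbours. -/
def hull (ω : KEdge n → Bool) (B : Finset (Fin n)) : Finset (Fin n) :=
  Finset.univ.filter fun x => x ∈ B ∨ ∃ y ∈ B, (graphOf ω).Adj y x

/-- One step of an exploration that stops as soon as it would reach `M` vertices. -/
def exploreStep (M : ℕ) (ω : KEdge n → Bool) (B : Finset (Fin n)) : Finset (Fin n) :=
  if (hull ω B).card < M then hull ω B else B

/-- The set of vertices explored from `r`: the largest ball around `r` with less than `M`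
vertices. -/
def explored (M : ℕ) (ω : KEdge n → Bool) (r : Fin n) : Finset (Fin n) :=
  (exploreStep M ω)^[n] {r}

theorem subset_hull (ω : KEdge n → Bool) (B : Finset (Fin n)) : B ⊆ hull ω B := fun x hx => by
  simp [hull, hx]

theorem subset_exploreStep (M : ℕ) (ω : KEdge n → Bool) (B : Finset (Fin n)) :
    B ⊆ exploreStep M ω B := by
  unfold exploreStep; split_ifs
  · exact subset_hull ω B
  · exact subset_rfl

theorem exploreStep_iterate_mono (M : ℕ) (ω : KEdge n → Bool) (r : Fin n) :
    Monotone fun j => (exploreStep M ω)^[j] {r} :=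
  monotone_nat_of_le_succ fun j => by
    rw [Function.iterate_succ_apply']
    exact subset_exploreStep M ω _

theorem hull_subset_cluster {ω : KEdge n → Bool} {B : Finset (Fin n)} {r : Fin n}
    (hB : B ⊆ cluster ω r) : hull ω B ⊆ cluster ω r := by
  intro x hx
  simp only [hull, Finset.mem_filter, Finset.mem_univ, true_and] at hx
  rcases hx with hx | ⟨y, hy, ha⟩
  · exact hB hx
  · exact mem_cluster.mpr ((mem_cluster.mp (hB hy)).trans ha.reachable)

theorem iterate_subset_cluster (M : ℕ) (ω : KEdge n → Bool) (r : Fin n) (j : ℕ) :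
    (exploreStep M ω)^[j] {r} ⊆ cluster ω r := by
  induction j with
  | zero =>
    intro x hx
    simp only [Function.iterate_zero, id, Finset.mem_singleton] at hx
    subst hx
    exact mem_cluster.mpr (SimpleGraph.Reachable.refl x)
  | succ j ih =>
    rw [Function.iterate_succ_apply']
    unfold exploreStep at ih ⊢
    split_ifs
    · exact hull_subset_cluster ih
    · exact ih

theorem iterate_card_le {M : ℕ} (hM : 1 ≤ M) (ω : KEdge n → Bool) (r : Fin n) (j : ℕ) :
    ((exploreStep M ω)^[j] {r}).card ≤ M := by
  induction j with
  | zero => simpa using hM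
  | succ j ih =>
    rw [Function.iterate_succ_apply']
    unfold exploreStep at ih ⊢
    split_ifs with h
    · exact h.le
    · exact ih

theorem card_explored_le {M : ℕ} (hM : 1 ≤ M) (ω : KEdge n → Bool) (r : Fin n) :
    ((explored M ω r).card : ℝ) ≤ min ((cluster ω r).card : ℝ) (M : ℝ) :=
  le_min (by exact_mod_cast Finset.card_le_card (iterate_subset_cluster M ω r n))
    (by exact_mod_cast iterate_card_le hM ω r n)

theorem mem_explored_self (M : ℕ) (ω : KEdge n → Bool) (r : Fin n) : r ∈ explored M ω r :=
  exploreStep_iterate_mono M ω r (Nat.zero_le n) (by simp)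

/-- Until it stabilizes, each step adds a vertex; since there are only n vertices, n steps suffice.
-/
theorem exploreStep_explored (M : ℕ) (ω : KEdge n → Bool) (r : Fin n) :
    exploreStep M ω (explored M ω r) = explored M ω r := by
  have h : ∀ j, exploreStep M ω ((exploreStep M ω)^[j] {r}) = (exploreStep M ω)^[j] {r} ∨
      j + 1 ≤ ((exploreStep M ω)^[j] {r}).card := by
    intro j
    induction j with
    | zero => right; simp
    | succ j ih =>
      rw [Function.iterate_succ_apply']
      by_cases hj : exploreStep M ω ((exploreStep M ω)^[j] {r}) = (exploreStep M ω)^[j] {r}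
      · left; rw [hj, hj]
      · right
        have h1 := ih.resolve_left hj
        have h2 := Finset.card_lt_card
          ((subset_exploreStep M ω ((exploreStep M ω)^[j] {r})).ssubset_of_ne (Ne.symm hj))
        omega
  rcases h n with h | h
  · exact h
  · have := Finset.card_le_univ ((exploreStep M ω)^[n] {r})
    rw [Fintype.card_fin] at this
    omega

/-- If the hull is smaller than M, the stopped exploration equals its own hull and is therefore the
whole component. Edges touching the explored vertices thus decide the event. -/
theorem le_card_cluster_iff (M : ℕ) (ω : KEdge n → Bool) (r : Fin n) :
    M ≤ (cluster ω r).card ↔ M ≤ (hull ω (explored M ω r)).card := by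
  constructor
  · intro h
    by_contra! hlt
    have hfix := exploreStep_explored M ω r
    rw [exploreStep, if_pos hlt] at hfix
    have hcl : cluster ω r ⊆ explored M ω r := by
      intro w hw
      rw [mem_cluster, SimpleGraph.reachable_iff_reflTransGen] at hw
      induction hw with
      | refl => exact mem_explored_self M ω r
      | @tail x y _ hxy ih =>
        rw [← hfix]
        simp only [hull, Finset.mem_filter, Finset.mem_univ, true_and]
        exact Or.inr ⟨x, ih, hxy⟩
    rw [hfix] at hlt
    have := Finset.card_le_card hcl
    omega
  · intro h
    exact h.trans (Finset.card_le_card (hull_subset_cluster (iterate_subset_cluster M ω r n)))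

open Classical in
/-- The edges that touch the vertices explored from the seeds `r` with `R r = true`. -/
def revealed (M : ℕ) (R : Fin n → Bool) (ω : KEdge n → Bool) : Finset (KEdge n) :=
  Finset.univ.filter fun e => ∃ r, R r = true ∧ ∃ x ∈ explored M ω r, x ∈ e.1

theorem hull_congr {ω η : KEdge n → Bool} {B : Finset (Fin n)}
    (h : ∀ e : KEdge n, (∃ x ∈ B, x ∈ e.1) → ω e = η e) : hull ω B = hull η B := by
  ext x
  simp only [hull, Finset.mem_filter, Finset.mem_univ, true_and]
  refine or_congr_right (exists_congr fun y => and_congr_right fun hy => ?_)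
  rw [graphOf_adj, graphOf_adj]
  refine exists_congr fun hne => ?_
  rw [h (edge hne) ⟨y, hy, Sym2.mem_mk_left y x⟩]

/-- Each step inspects only edges touching the current set, which is contained in the final one. -/
theorem explored_congr {M : ℕ} {ω η : KEdge n → Bool} {r : Fin n}
    (h : ∀ e : KEdge n, (∃ x ∈ explored M ω r, x ∈ e.1) → ω e = η e) :
    explored M η r = explored M ω r := by
  have : ∀ j ≤ n, (exploreStep M η)^[j] {r} = (exploreStep M ω)^[j] {r} := by
    intro j
    induction j with
    | zero => intro _; rfl
    | succ j ih =>
      intro hj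
      rw [Function.iterate_succ_apply', Function.iterate_succ_apply', ih (by omega)]
      unfold exploreStep
      rw [hull_congr (ω := ω) (η := η)]
      rintro e ⟨x, hx, hxe⟩
      exact h e ⟨x, exploreStep_iterate_mono M ω r (by omega : j ≤ n) hx, hxe⟩
  exact this n le_rfl

theorem agree_of_revealed {M : ℕ} {R : Fin n → Bool} {ω η : KEdge n → Bool}
    (h : ∀ e ∈ revealed M R ω, ω e = η e) {r : Fin n} (hr : R r = true) (e : KEdge n)
    (he : ∃ x ∈ explored M ω r, x ∈ e.1) : ω e = η e :=
  h e (by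
    simp only [revealed, Finset.mem_filter, Finset.mem_univ, true_and]
    exact ⟨r, hr, he⟩)

theorem isStoppingSet_revealed (M : ℕ) (R : Fin n → Bool) : IsStoppingSet (revealed M R) := by
  intro ω η h
  ext e
  simp only [revealed, Finset.mem_filter, Finset.mem_univ, true_and]
  refine exists_congr fun r => and_congr_right fun hr => ?_
  rw [explored_congr (agree_of_revealed h hr)]

open Classical in
/-- The indicator that some seed lies in a component with at least `M` vertices. -/
def seedInd (M : ℕ) (R : Fin n → Bool) (ω : KEdge n → Bool) : ℝ :=
  if ∃ r, R r = true ∧ M ≤ (cluster ω r).card then 1 else 0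

theorem determinedBy_seedInd (M : ℕ) (R : Fin n → Bool) :
    DeterminedBy (seedInd M R) (revealed M R) := by
  intro ω η h
  have : ∀ r, (R r = true ∧ M ≤ (cluster η r).card) ↔ (R r = true ∧ M ≤ (cluster ω r).card) := by
    refine fun r => and_congr_right fun hr => ?_
    have ha := agree_of_revealed h hr
    rw [le_card_cluster_iff, le_card_cluster_iff, explored_congr ha, hull_congr ha]
  simp only [seedInd, this]

/-! ### Vertex symmetry and the revealment bound -/

/-- The action of a vertex permutation on edges. -/
def permEdge (σ : Equiv.Perm (Fin n)) : KEdge n ≃ KEdge n :=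
  (SimpleGraph.Iso.completeGraph σ).mapEdgeSet

theorem graphOf_perm_adj (σ : Equiv.Perm (Fin n)) (ω : KEdge n → Bool) (x y : Fin n) :
    (graphOf fun e => ω (permEdge σ e)).Adj x y ↔ (graphOf ω).Adj (σ x) (σ y) := by
  rw [graphOf_adj, graphOf_adj]
  constructor
  · rintro ⟨h, hω⟩
    exact ⟨σ.injective.ne h, hω⟩
  · rintro ⟨h, hω⟩
    exact ⟨fun hc => h (congrArg σ hc), hω⟩

theorem ex_comp_equiv {E : Type} [Fintype E] [DecidableEq E] (p : ℝ) (τ : E ≃ E)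
    (f : (E → Bool) → ℝ) : ex p (fun ω => f fun e => ω (τ e)) = ex p f := by
  unfold ex
  rw [← Equiv.sum_comp (Equiv.arrowCongr τ.symm (Equiv.refl Bool)) fun ω => weight p ω * f ω]
  refine Finset.sum_congr rfl fun ω _ => ?_
  have : weight p ω = weight p fun e => ω (τ e) := by
    rw [weight_eq_prod, weight_eq_prod, Equiv.prod_comp τ fun e => bitMass p (ω e)]
  rw [this]
  rfl

theorem map_hull_perm (σ : Equiv.Perm (Fin n)) (ω : KEdge n → Bool) (B : Finset (Fin n)) :
    (hull (fun e => ω (permEdge σ e)) B).map σ.toEmbedding = hull ω (B.map σ.toEmbedding) := by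
  ext x
  obtain ⟨x, rfl⟩ := σ.surjective x
  have h : ∀ C : Finset (Fin n), σ x ∈ C.map σ.toEmbedding ↔ x ∈ C := fun C =>
    Finset.mem_map' σ.toEmbedding
  rw [h]
  simp only [hull, Finset.mem_filter, Finset.mem_univ, true_and, h, graphOf_perm_adj]
  refine or_congr_right ⟨?_, ?_⟩
  · rintro ⟨y, hy, ha⟩
    exact ⟨σ y, Finset.mem_map_of_mem σ.toEmbedding hy, ha⟩
  · rintro ⟨y, hy, ha⟩
    obtain ⟨z, hz, rfl⟩ := Finset.mem_map.mp hy
    exact ⟨z, hz, ha⟩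

theorem map_explored_perm (M : ℕ) (σ : Equiv.Perm (Fin n)) (ω : KEdge n → Bool) (r : Fin n) :
    (explored M (fun e => ω (permEdge σ e)) r).map σ.toEmbedding = explored M ω (σ r) := by
  have h : Function.Semiconj (fun B : Finset (Fin n) => B.map σ.toEmbedding)
      (exploreStep M fun e => ω (permEdge σ e)) (exploreStep M ω) := by
    intro B
    dsimp only
    unfold exploreStep
    rw [← map_hull_perm, Finset.card_map]
    split_ifs <;> rfl
  have := (h.iterate_right n) {r}
  simpa [explored] using this

/-- Exchangeability of the roles of the seed and of the explored vertex. -/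
theorem ex_mem_explored_comm (p : ℝ) (M : ℕ) (u r : Fin n) :
    ex p (fun ω : KEdge n → Bool => if u ∈ explored M ω r then (1 : ℝ) else 0) =
      ex p fun ω : KEdge n → Bool => if r ∈ explored M ω u then (1 : ℝ) else 0 := by
  rw [← ex_comp_equiv p (permEdge (Equiv.swap u r))]
  congr 1; funext ω
  have h := map_explored_perm M (Equiv.swap u r) ω r
  rw [Equiv.swap_apply_right] at h
  rw [← h]
  have h2 := Finset.mem_map' (Equiv.swap u r).toEmbedding (a := u)
    (s := explored M (fun e => ω (permEdge (Equiv.swap u r) e)) r)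
  rw [Equiv.coe_toEmbedding, Equiv.swap_apply_left] at h2
  simp only [h2]

/-- Exchanging u and r turns the sum into the mean of |`explored M ω u`|, which the truncated
component size dominates. -/
theorem sum_ex_mem_explored_le (hn : 2 ≤ n) {M : ℕ} (hM : 1 ≤ M) (u : Fin n) :
    ∑ r, ex (1 / (n : ℝ)) (fun ω : KEdge n → Bool =>
      if u ∈ explored M ω r then (1 : ℝ) else 0) ≤ 4 * √M := by
  have hn' : (2 : ℝ) ≤ n := by exact_mod_cast hn
  have hp0 : (0 : ℝ) ≤ 1 / n := by positivity
  have hp1 : (1 : ℝ) / n ≤ 1 := by rw [div_le_one] <;> linarith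
  simp_rw [ex_mem_explored_comm _ M u]
  rw [← ex_sum]
  refine le_trans (ex_mono hp0 hp1 fun ω => ?_) (ex_min_cluster_le hn hM u)
  refine le_trans (le_of_eq ?_) (card_explored_le hM ω u)
  simp

-- A revealed edge has an endpoint explored from some seed. Seeds are independent of the graph, so
-- the union bound gives q times 4√M for each of the two endpoints.
open Classical in
theorem revealment_le (hn : 2 ≤ n) {M : ℕ} (hM : 1 ≤ M) {q : ℝ} (hq0 : 0 ≤ q) (hq1 : q ≤ 1)
    (e : KEdge n) :
    ex q (fun R : Fin n → Bool => ex (1 / (n : ℝ)) fun ω : KEdge n → Bool =>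
      if e ∈ revealed M R ω then (1 : ℝ) else 0) ≤ 8 * q * √M := by
  have hn' : (2 : ℝ) ≤ n := by exact_mod_cast hn
  have hp0 : (0 : ℝ) ≤ 1 / n := by positivity
  have hp1 : (1 : ℝ) / n ≤ 1 := by rw [div_le_one] <;> linarith
  obtain ⟨u, w, huw⟩ : ∃ u w, e.1 = s(u, w) := by
    induction e.1 using Sym2.ind with
    | _ u w => exact ⟨u, w, rfl⟩
  let a : Fin n → Fin n → (KEdge n → Bool) → ℝ := fun x r ω =>
    if x ∈ explored M ω r then 1 else 0
  have ha : ∀ x r ω, 0 ≤ a x r ω := fun x r ω => by simp only [a]; split_ifs <;> norm_num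
  have hpt : ∀ (R : Fin n → Bool) (ω : KEdge n → Bool),
      (if e ∈ revealed M R ω then (1 : ℝ) else 0) ≤
      ∑ r, (if R r = true then (1 : ℝ) else 0) * (a u r ω + a w r ω) := by
    intro R ω
    have hnn : ∀ r ∈ Finset.univ,
        0 ≤ (if R r = true then (1 : ℝ) else 0) * (a u r ω + a w r ω) := fun r _ =>
      mul_nonneg (by split_ifs <;> norm_num) (add_nonneg (ha _ _ _) (ha _ _ _))
    split_ifs with he
    · simp only [revealed, Finset.mem_filter, Finset.mem_univ, true_and, huw] at he
      obtain ⟨r, hr, x, hx, hxe⟩ := he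
      refine le_trans ?_ (Finset.single_le_sum hnn (Finset.mem_univ r))
      rw [if_pos hr, one_mul]
      have h1 : a x r ω = 1 := if_pos hx
      rcases Sym2.mem_iff.mp hxe with rfl | rfl
      · linarith [ha w r ω]
      · linarith [ha u r ω]
    · exact Finset.sum_nonneg hnn
  refine (ex_mono hq0 hq1 fun R => ex_mono hp0 hp1 (hpt R)).trans ?_
  simp_rw [ex_sum, ex_const_mul, ex_add]
  have h1 : ∀ r : Fin n, ex q (fun R : Fin n → Bool => (if R r = true then (1 : ℝ) else 0) *
      (ex (1 / (n : ℝ)) (a u r) + ex (1 / (n : ℝ)) (a w r))) =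
      q * (ex (1 / (n : ℝ)) (a u r) + ex (1 / (n : ℝ)) (a w r)) := by
    intro r
    simp_rw [mul_comm _ (ex (1 / (n : ℝ)) (a u r) + _)]
    rw [ex_const_mul, ex_coord]
  simp_rw [h1]
  rw [← Finset.mul_sum, Finset.sum_add_distrib]
  have h2 := sum_ex_mem_explored_le hn hM u
  have h3 := sum_ex_mem_explored_le hn hM w
  have := mul_le_mul_of_nonneg_left (add_le_add h2 h3) hq0
  refine this.trans (le_of_eq ?_)
  ring

theorem largestComponentSize_ge_iff {M : ℕ} (hM : 1 ≤ M) (ω : KEdge n → Bool) :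
    M ≤ largestComponentSize (graphOf ω) ↔ ∃ r, M ≤ (cluster ω r).card := by
  have hc : ∀ r, ((graphOf ω).connectedComponentMk r).supp.ncard = (cluster ω r).card := by
    intro r
    rw [← Set.ncard_coe_finset]
    congr 1
    ext x
    simp only [SimpleGraph.ConnectedComponent.mem_supp_iff, SimpleGraph.ConnectedComponent.eq,
      Finset.mem_coe, mem_cluster]
    exact ⟨fun h => h.symm, fun h => h.symm⟩
  have hbdd : BddAbove (Set.range fun c : (graphOf ω).ConnectedComponent => c.supp.ncard) :=
    Set.Finite.bddAbove (Set.finite_range _)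
  constructor
  · intro h
    by_contra! hcon
    -- The truncated subtraction is harmless because 1 ≤ M.
    have : largestComponentSize (graphOf ω) ≤ M - 1 := by
      refine ciSup_le' fun c => ?_
      induction c using SimpleGraph.ConnectedComponent.ind with
      | _ v => rw [hc]; have := hcon v; omega
    omega
  · rintro ⟨r, hr⟩
    exact hr.trans ((hc r).symm.le.trans (le_ciSup hbdd _))

end Exploration

/-! ### Seed approximation and the choice of parameters -/

section Main

variable {n : ℕ}

theorem largeComponentIndicator_eq {a : ℝ} (ha : 0 < a) (hn : 1 ≤ n) (ω : KEdge n → Bool) :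
    largeComponentIndicator a n ω =
      if ∃ r, ⌈a * (n : ℝ) ^ (2 / 3 : ℝ)⌉₊ ≤ (cluster ω r).card then 1 else 0 := by
  have hn' : (0 : ℝ) < n := by exact_mod_cast hn
  have hM : 1 ≤ ⌈a * (n : ℝ) ^ (2 / 3 : ℝ)⌉₊ := Nat.one_le_ceil_iff.mpr (by positivity)
  have h : a * (n : ℝ) ^ (2 / 3 : ℝ) ≤ (largestComponentSize (graphOf ω) : ℝ) ↔
      ∃ r, ⌈a * (n : ℝ) ^ (2 / 3 : ℝ)⌉₊ ≤ (cluster ω r).card := by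
    rw [← largestComponentSize_ge_iff hM, Nat.ceil_le]
  simp only [largeComponentIndicator, h]

theorem cluster_eq_of_mem {ω : KEdge n → Bool} {r x : Fin n} (hx : x ∈ cluster ω r) :
    cluster ω x = cluster ω r := by
  rw [mem_cluster] at hx
  ext y
  rw [mem_cluster, mem_cluster]
  exact ⟨fun h => hx.trans h, fun h => hx.symm.trans h⟩

/-- Random seeds hit a component with at least `M` vertices with high probability. -/
theorem abs_indicator_sub_ex_seedInd_le {q : ℝ} (hq0 : 0 ≤ q) (hq1 : q ≤ 1) (M : ℕ)
    (ω : KEdge n → Bool) :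
    |(if ∃ r, M ≤ (cluster ω r).card then (1 : ℝ) else 0) -
      ex q fun R : Fin n → Bool => seedInd M R ω| ≤ (1 - q) ^ M := by
  split_ifs with h
  · obtain ⟨r, hr⟩ := h
    have hle : ex q (fun R : Fin n → Bool => seedInd M R ω) ≤ 1 := by
      rw [← ex_const (E := Fin n) q 1]
      refine ex_mono hq0 hq1 fun R => ?_
      unfold seedInd; split_ifs <;> norm_num
    rw [abs_of_nonneg (by linarith)]
    have h1 : 1 - ex q (fun R : Fin n → Bool => seedInd M R ω) =
        ex q fun R : Fin n → Bool => 1 - seedInd M R ω := by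
      rw [ex_sub, ex_const]
    rw [h1]
    have h2 : ex q (fun R : Fin n → Bool => 1 - seedInd M R ω) ≤
        ex q fun R : Fin n → Bool =>
          if ∀ x ∈ cluster ω r, R x = false then (1 : ℝ) else 0 := by
      refine ex_mono hq0 hq1 fun R => ?_
      by_cases hR : ∀ x ∈ cluster ω r, R x = false
      · rw [if_pos hR]
        unfold seedInd; split_ifs <;> norm_num
      · rw [if_neg hR]
        push Not at hR
        obtain ⟨x, hx, hRx⟩ := hR
        have : ∃ r, R r = true ∧ M ≤ (cluster ω r).card :=
          ⟨x, by simpa using hRx, by rwa [cluster_eq_of_mem hx]⟩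
        rw [seedInd, if_pos this, sub_self]
    refine h2.trans (le_trans (le_of_eq ?_)
      (pow_le_pow_of_le_one (by linarith) (by linarith) hr))
    convert ex_all_false q (cluster ω r)
  · have : ∀ R : Fin n → Bool, seedInd M R ω = 0 := by
      intro R
      exact if_neg fun ⟨r, _, hr⟩ => h ⟨r, hr⟩
    simp_rw [this]
    rw [ex_const, sub_zero, abs_zero]
    exact pow_nonneg (by linarith) M

theorem noise_covariance_largeComponent_le {a : ℝ} (ha : 0 < a) (hn : 2 ≤ n) {ε q : ℝ}
    (hε0 : 0 < ε) (hε1 : ε ≤ 1) (hq0 : 0 < q) (hq1 : q ≤ 1) :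
    noisyExpect (1 / (n : ℝ)) ε (largeComponentIndicator a n) (largeComponentIndicator a n) -
        expect (1 / (n : ℝ)) (largeComponentIndicator a n) ^ 2 ≤
      2 * (8 * q * √⌈a * (n : ℝ) ^ (2 / 3 : ℝ)⌉₊ / ε ^ 2) +
        2 * ((1 - q) ^ ⌈a * (n : ℝ) ^ (2 / 3 : ℝ)⌉₊) ^ 2 := by
  classical
  have hn' : (2 : ℝ) ≤ n := by exact_mod_cast hn
  have hp0 : (0 : ℝ) < 1 / n := by positivity
  have hp1 : (1 : ℝ) / n < 1 := by rw [div_lt_one] <;> linarith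
  set M := ⌈a * (n : ℝ) ^ (2 / 3 : ℝ)⌉₊ with hMdef
  have hM : 1 ≤ M := Nat.one_le_ceil_iff.mpr (by positivity)
  have hM0 : (0 : ℝ) < M := by exact_mod_cast hM
  have hδ : 0 < 8 * q * √M := by positivity
  refine noisyExpect_sub_sq_le hp0 hp1 hε0 hε1 hδ.le (largeComponentIndicator a n)
    (fun ω => ex q fun R : Fin n → Bool => seedInd M R ω) (fun ω => ?_) fun k hk => ?_
  · rw [largeComponentIndicator_eq ha (by omega)]
    exact abs_indicator_sub_ex_seedInd_le hq0.le hq1 M ω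
  · refine fourier_weight_le hp0 hp1 hq0.le hq1 (revealed M) (seedInd M)
      (isStoppingSet_revealed M) (determinedBy_seedInd M) (fun R ω => ?_) hδ
      (fun e => ?_) hk
    · unfold seedInd; split_ifs <;> norm_num
    · convert revealment_le hn hM hq0.le hq1 e

/-- Take q = K/n^(2/3), a probability by `hKn`: then qM ≥ aK controls the missed components, while
q√M is of order K n^(-1/3), the source of the exponent 1/6. -/
theorem noise_covariance_largeComponent_le' {a : ℝ} (ha : 0 < a) (hn : 2 ≤ n) {ε K : ℝ}
    (hε0 : 0 < ε) (hε1 : ε ≤ 1) (hK : 0 < K) (hKn : K ≤ (n : ℝ) ^ (2 / 3 : ℝ)) :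
    noisyExpect (1 / (n : ℝ)) ε (largeComponentIndicator a n) (largeComponentIndicator a n) -
        expect (1 / (n : ℝ)) (largeComponentIndicator a n) ^ 2 ≤
      16 * K * √(a + 1) / ((n : ℝ) ^ (1 / 6 : ℝ) * ε) ^ 2 + 2 * Real.exp (-(a * K)) ^ 2 := by
  have hn' : (2 : ℝ) ≤ n := by exact_mod_cast hn
  have hx1 : 1 ≤ (n : ℝ) ^ (1 / 6 : ℝ) := Real.one_le_rpow (by linarith) (by norm_num)
  have hx4 : (n : ℝ) ^ (2 / 3 : ℝ) = ((n : ℝ) ^ (1 / 6 : ℝ)) ^ 4 := by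
    rw [← Real.rpow_natCast, ← Real.rpow_mul (by linarith)]; norm_num
  have hx4' : 0 < (n : ℝ) ^ (2 / 3 : ℝ) := by positivity
  have hq1 : K / (n : ℝ) ^ (2 / 3 : ℝ) ≤ 1 := (div_le_one hx4').mpr hKn
  refine (noise_covariance_largeComponent_le ha hn hε0 hε1
    (q := K / (n : ℝ) ^ (2 / 3 : ℝ)) (by positivity) hq1).trans ?_
  set M := ⌈a * (n : ℝ) ^ (2 / 3 : ℝ)⌉₊
  have hM1 : a * (n : ℝ) ^ (2 / 3 : ℝ) ≤ M := Nat.le_ceil _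
  have hM2 : (M : ℝ) ≤ a * (n : ℝ) ^ (2 / 3 : ℝ) + 1 := (Nat.ceil_lt_add_one (by positivity)).le
  rw [hx4] at hM1 hM2 hq1 ⊢
  set x := (n : ℝ) ^ (1 / 6 : ℝ)
  have hx0 : 0 < x := by linarith
  refine add_le_add ?_ ?_
  · have h1 : √(M : ℝ) ≤ √(a + 1) * x ^ 2 := by
      rw [← Real.sqrt_sq (by positivity : 0 ≤ x ^ 2), ← Real.sqrt_mul (by linarith)]
      refine Real.sqrt_le_sqrt (hM2.trans ?_)
      have : 1 ≤ x ^ 4 := one_le_pow₀ hx1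
      nlinarith
    have h2 : 2 * (8 * (K / x ^ 4) * √(M : ℝ) / ε ^ 2) ≤
        2 * (8 * (K / x ^ 4) * (√(a + 1) * x ^ 2) / ε ^ 2) := by gcongr
    refine h2.trans (le_of_eq ?_)
    field_simp
    ring
  · have h1 : (1 - K / x ^ 4) ^ M ≤ Real.exp (-(a * K)) := by
      have h2 := Real.add_one_le_exp (-(K / x ^ 4))
      refine (pow_le_pow_left₀ (by linarith) (by linarith : 1 - K / x ^ 4 ≤ _) M).trans ?_
      rw [← Real.exp_nat_mul, Real.exp_le_exp]
      have h3 := mul_le_mul_of_nonneg_right hM1 (by positivity : 0 ≤ K / x ^ 4)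
      have h4 : a * x ^ 4 * (K / x ^ 4) = a * K := by field_simp
      linarith
    have h0 : 0 ≤ (1 - K / x ^ 4) ^ M := pow_nonneg (by linarith) M
    gcongr

end Main
end NoiseER
end

theorem proposition2p1 (a : ℝ) (ha : 0 < a) (ε : ℕ → ℝ)
    (hε : ∀ n : ℕ, 1 ≤ n → ε n ∈ Set.Icc (0 : ℝ) 1)
    (hlim : Tendsto (fun n : ℕ => (n : ℝ) ^ (1 / 6 : ℝ) * ε n) atTop atTop) :
    NoiseER.QuantNoiseSensitive NoiseER.KEdge (fun n => 1 / (n : ℝ))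
      (NoiseER.largeComponentIndicator a) ε := by
  unfold NoiseER.QuantNoiseSensitive
  rw [tendsto_order]
  constructor
  -- The covariance is nonnegative, being a Fourier sum with nonnegative terms; n ≥ 2 ensures 0 <
  -- 1/n < 1.
  · intro b hb
    filter_upwards [eventually_ge_atTop 2] with n hn
    have hn' : (2 : ℝ) ≤ n := by exact_mod_cast hn
    obtain ⟨h0, h1⟩ := hε n (by omega)
    exact hb.trans_le (NoiseER.noisyExpect_sub_sq_nonneg (by positivity)
      (by rw [div_lt_one] <;> linarith) h0 h1 _)
  · intro τ hτ
    have hexp : Tendsto (fun K : ℝ => 2 * Real.exp (-(a * K)) ^ 2) atTop (𝓝 (2 * 0 ^ 2)) :=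
      ((Real.tendsto_exp_neg_atTop_nhds_zero.comp
        (tendsto_id.const_mul_atTop ha)).pow 2).const_mul 2
    -- K is fixed from τ alone, making the approximation error small; the other term then vanishes
    -- as n grows.
    obtain ⟨K, hKτ, hK⟩ := ((hexp.eventually_lt_const
      (show 2 * (0 : ℝ) ^ 2 < τ / 2 by simpa using hτ)).and
      (eventually_gt_atTop (0 : ℝ))).exists
    have hmain : Tendsto (fun n : ℕ =>
        16 * K * √(a + 1) / ((n : ℝ) ^ (1 / 6 : ℝ) * ε n) ^ 2) atTop (𝓝 0) :=
      tendsto_const_nhds.div_atTop ((tendsto_pow_atTop two_ne_zero).comp hlim)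
    have hpow : Tendsto (fun n : ℕ => (n : ℝ) ^ (2 / 3 : ℝ)) atTop atTop :=
      (tendsto_rpow_atTop (by norm_num)).comp tendsto_natCast_atTop_atTop
    filter_upwards [eventually_ge_atTop 2, hmain.eventually_lt_const (half_pos hτ),
      hpow.eventually_ge_atTop K, hlim.eventually_gt_atTop 0] with n hn h1 h2 h3
    have hε0 : 0 < ε n := pos_of_mul_pos_right h3 (by positivity)
    exact (NoiseER.noise_covariance_largeComponent_le' ha hn hε0 (hε n (by omega)).2 hK h2).trans_lt
      ((add_lt_add h1 hKτ).trans_eq (add_halves τ))
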